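/- Fix a real number $\theta>0$ and a positive integer $r$. There exists a constant $C_r$, depending only on $r$ and $\theta$, such that the following holds. Let $N\ge 1$, let $\mathbf i=(i_1,\dots,i_r)$ and $\mathbf s=(s_1,\dots,s_r)$ be any lists of elements of $[N]=\{1,\dots,N\}$, let $\tau=(\tau_1,\dots,\tau_\ell)$ be any set partition of $[r]$, and let $\sigma$ be an Ewens random permutation in $S_N$ with parameter $\theta$, i.e. $$\mathbb P(\sigma=\rho)=\frac{\theta^{\#(\rho)}}{\theta(\theta+1)\cdots(\theta+N-1)}\qquad(\rho\in S_N),$$ where $\#(\rho)$ is the number of cycles of $\rho$ (fixed points included). For $a,b\in[N]$ let $B^{(N)}_{a,b}$ be the indicator variable of the event $\sigma(a)=b$. Then $$\left|\kappa\left(\prod_{j\in\tau_1}B^{(N)}_{i_j,s_j},\dots,\prod_{j\in\tau_\ell}B^{(N)}_{i_j,s_j}\right)\right|\le C_r\,N^{-\#(\mathrm{Conn}(G_1))-\#(\mathrm{Conn}(G_2)\vee\tau)+1}.$$ Here: - $\kappa(X_1,\dots,X_\ell)=[t_1\cdots t_\ell]\,\ln\mathbb E\big(\exp(t_1X_1+\dots+t_\ell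 X_\ell)\big)$ is the joint cumulant, where $[t_1\cdots t_\ell]F$ is the coefficient of $t_1\cdots t_\ell$ in the power series expansion of $F$ at $0$; - $G_1=G_1(\mathbf i,\mathbf s)$ is the graph with vertex set $[r]$ in which distinct $j,h$ are linked if and only if $i_j=i_h$ and $s_j=s_h$; - $G_2=G_2(\mathbf i,\mathbf s)$ is the graph with vertex set $[r]$ in which distinct $j,h$ are linked if and only if $\{i_j,s_j\}\cap\{i_h,s_h\}\neq\emptyset$; - $\mathrm{Conn}(G)$ is the set partition of $[r]$ into the vertex sets of the connected components of $G$, $\#(\pi)$ is the number of parts of a set partition $\pi$, and $\pi\vee\pi'$ is the finest set partition that is coarser than both $\pi$ and $\pi'$. -/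

import Mathlib

open MeasureTheory

noncomputable section

/-- All subsets of the finite set `S_N` are measurable. -/
instance instMeasurableSpacePermFin (N : ℕ) : MeasurableSpace (Equiv.Perm (Fin N)) := ⊤

instance instDiscreteMeasurableSpacePermFin (N : ℕ) :
    DiscreteMeasurableSpace (Equiv.Perm (Fin N)) := ⟨fun _ => trivial⟩

/-- The number of cycles of a permutation, fixed points included. -/
def numCycles {N : ℕ} (σ : Equiv.Perm (Fin N)) : ℕ :=
  σ.partition.parts.card

/-- The Ewens measure with parameter `θ` on `S_N`: the permutation `σ` has mass
`θ ^ #(σ) / (θ (θ + 1) ⋯ (θ + N - 1))`. -/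
def ewensMeasure (θ : ℝ) (N : ℕ) : Measure (Equiv.Perm (Fin N)) :=
  ∑ σ : Equiv.Perm (Fin N),
    ENNReal.ofReal (θ ^ numCycles σ / ∏ k ∈ Finset.range N, (θ + k)) • Measure.dirac σ

/-- The joint cumulant `κ(X_1, …, X_ℓ)`: the coefficient of `t_1 ⋯ t_ℓ` in the expansion of
`ln E[exp(t_1 X_1 + ⋯ + t_ℓ X_ℓ)]` at `t = 0`, that is, the mixed partial derivative
`∂^ℓ / ∂t_1 ⋯ ∂t_ℓ` of this function at `0`. -/
def jointCumulant {Ω : Type*} [MeasurableSpace Ω] (P : Measure Ω) {ℓ : ℕ}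
    (X : Fin ℓ → Ω → ℝ) : ℝ :=
  iteratedFDeriv ℝ ℓ
    (fun t : Fin ℓ → ℝ => Real.log (∫ ω, Real.exp (∑ h, t h * X h ω) ∂P)) 0
    (fun h => Pi.single h 1)

/-- The elementary variable `B_{a,b}`, equal to `1` if `σ(a) = b` and to `0` otherwise. -/
def elemVar {Ω : Type*} {N : ℕ} (σ : Ω → Equiv.Perm (Fin N)) (a b : Fin N) (ω : Ω) : ℝ :=
  if σ ω a = b then 1 else 0

/-- The graph `G_1(i, s)` on `[r]`: distinct `j`, `h` are linked iff `i_j = i_h` and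
`s_j = s_h`. -/
def graphG1 {r N : ℕ} (i s : Fin r → Fin N) : SimpleGraph (Fin r) where
  Adj j h := j ≠ h ∧ i j = i h ∧ s j = s h
  symm := ⟨fun _ _ hjh => ⟨hjh.1.symm, hjh.2.1.symm, hjh.2.2.symm⟩⟩
  loopless := ⟨fun _ hj => hj.1 rfl⟩

/-- The graph `G_2(i, s)` on `[r]`: distinct `j`, `h` are linked iff
`{i_j, s_j} ∩ {i_h, s_h} ≠ ∅`. -/
def graphG2 {r N : ℕ} (i s : Fin r → Fin N) : SimpleGraph (Fin r) where
  Adj j h := j ≠ h ∧ (({i j, s j} : Set (Fin N)) ∩ {i h, s h}).Nonempty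
  symm := ⟨fun _ _ hjh => ⟨hjh.1.symm, by rw [Set.inter_comm]; exact hjh.2⟩⟩
  loopless := ⟨fun _ hj => hj.1 rfl⟩

/-- The equivalence relation "lying in the same part of `τ`". Through it, set partitions of `[r]`
are identified with equivalence relations on `[r]`; `≤` on `Setoid (Fin r)` is then the refinement
order (finer ≤ coarser) and `⊔` is the join of set partitions. -/
def partitionSetoid {r : ℕ} (τ : Finpartition (Finset.univ : Finset (Fin r))) :
    Setoid (Fin r) :=
  Setoid.ker τ.part

/-- The set partition `Conn(G)` into connected components, as an equivalence relation. -/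
def connSetoid {r : ℕ} (G : SimpleGraph (Fin r)) : Setoid (Fin r) :=
  G.reachableSetoid

/-- The number of parts of a set partition given as an equivalence relation. -/
def numParts {r : ℕ} (π : Setoid (Fin r)) : ℕ :=
  Nat.card (Quotient π)

end

/-!
The probability that an Ewens permutation extends a set of `k` pairs closing `c` cycles is
`θ ^ c / ((N + θ - 1) ⋯ (N + θ - k))`, the value at `θ ^ c X ^ k` of a linear functional `E_N` on
polynomials. A joint cumulant of products of the `B_{a,b}` is therefore a coefficient of the formal
logarithm of `E_N[F]`, where `F Δ` is the polynomial of the pairs in the blocks of `Δ`; only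
finitely many `F` occur once `r` is fixed, so it suffices to bound the cumulant as `N → ∞` for each
`F` separately, and the bound is automatically uniform in `N`, `i` and `s`.

The recursion between consecutive moments is an integration by parts for `E_N`. Since `F` is the
exponential of its formal logarithm `L`, it becomes a recursion for the tilted expectations
`E_N[p F] / E_N[F]`, from which they gain a factor `1 / N` for every power of `X` dividing `p` and
for every component of the index set. Here `L B` vanishes as soon as `B` meets two components,
because `F` is multiplicative over components, and it is divisible by a power of `X` whose exponent
is the number of distinct pairs in `B`: these are the two sources of the exponent in the bound.
-/

section UnipotentLog

variable {A : Type*} [CommRing A] [Algebra ℚ A]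

/-- The logarithm of a unipotent element `x`, as the finite sum `-∑ (1 - x) ^ n / n`; it is a
meaningless value when `1 - x` is not nilpotent. -/
noncomputable def unipotentLog (x : A) : A :=
  -∑ n ∈ Finset.range (nilpotencyClass (1 - x)), ((n + 1 : ℚ)⁻¹) • (1 - x) ^ (n + 1)

theorem unipotentLog_mem {B : Subalgebra ℚ A} {x : A} (hx : x ∈ B) : unipotentLog x ∈ B :=
  B.neg_mem (B.sum_mem fun _ _ => B.smul_mem (B.pow_mem (B.sub_mem B.one_mem hx) _) _)

theorem derivation_apply_eq_mul_unipotentLog {k : Type*} [CommSemiring k] [Algebra k A]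
    (d : Derivation k A A) {x : A} (hx : IsNilpotent (1 - x)) :
    d x = x * d (unipotentLog x) := by
  have hterm (n : ℕ) : d (((n + 1 : ℚ)⁻¹) • (1 - x) ^ (n + 1)) = -((1 - x) ^ n * d x) := by
    have hn : ((n : ℚ) + 1) ≠ 0 := by positivity
    rw [map_rat_smul d, Derivation.leibniz_pow, map_sub, d.map_one_eq_zero, zero_sub,
      Nat.add_sub_cancel, ← Nat.cast_smul_eq_nsmul ℚ, smul_smul, Nat.cast_succ,
      inv_mul_cancel₀ hn, one_smul, smul_eq_mul, mul_neg]
  have hgeom : x * ∑ n ∈ Finset.range (nilpotencyClass (1 - x)), (1 - x) ^ n = 1 := by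
    have := mul_neg_geom_sum (1 - x) (nilpotencyClass (1 - x))
    rwa [sub_sub_cancel, pow_nilpotencyClass hx, sub_zero] at this
  calc d x = x * (∑ n ∈ Finset.range (nilpotencyClass (1 - x)), (1 - x) ^ n) * d x := by
        rw [hgeom, one_mul]
    _ = x * d (unipotentLog x) := by
        rw [unipotentLog, map_neg, map_sum, Finset.sum_congr rfl fun n _ => hterm n,
          Finset.sum_neg_distrib, neg_neg, mul_assoc, Finset.sum_mul]

end UnipotentLog

/-- Multilinear formal series in variables `t h` indexed by `ι`: the coefficient of the monomial
`∏ h ∈ Δ, t h` is the value at `Δ`, and squares of variables vanish. -/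
def SetSeries (ι R : Type*) := Finset ι → R

namespace SetSeries

open Finset

variable {ι k R : Type*}

@[ext] theorem ext {f g : SetSeries ι R} (h : ∀ Δ, f Δ = g Δ) : f = g := funext h

noncomputable instance [AddCommGroup R] : AddCommGroup (SetSeries ι R) :=
  inferInstanceAs (AddCommGroup (Finset ι → R))

noncomputable instance [Semiring k] [AddCommGroup R] [Module k R] : Module k (SetSeries ι R) :=
  inferInstanceAs (Module k (Finset ι → R))

section Additive

variable [AddCommGroup R]

theorem zero_apply (Δ : Finset ι) : (0 : SetSeries ι R) Δ = 0 := rfl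

theorem add_apply (f g : SetSeries ι R) (Δ : Finset ι) : (f + g) Δ = f Δ + g Δ := rfl

theorem sub_apply (f g : SetSeries ι R) (Δ : Finset ι) : (f - g) Δ = f Δ - g Δ := rfl

theorem sum_apply {κ : Type*} (s : Finset κ) (f : κ → SetSeries ι R) (Δ : Finset ι) :
    (∑ i ∈ s, f i) Δ = ∑ i ∈ s, f i Δ :=
  Finset.sum_apply Δ s f

theorem smul_apply [Semiring k] [Module k R] (c : k) (f : SetSeries ι R) (Δ : Finset ι) :
    (c • f) Δ = c • f Δ := rfl

end Additive

section Ring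

variable [DecidableEq ι] [CommRing R]

instance : Mul (SetSeries ι R) := ⟨fun f g Δ => ∑ S ∈ Δ.powerset, f S * g (Δ \ S)⟩

instance : One (SetSeries ι R) := ⟨fun Δ => if Δ = ∅ then 1 else 0⟩

theorem one_apply (Δ : Finset ι) : (1 : SetSeries ι R) Δ = if Δ = ∅ then 1 else 0 := rfl

theorem mul_apply (f g : SetSeries ι R) (Δ : Finset ι) :
    (f * g) Δ = ∑ S ∈ Δ.powerset, f S * g (Δ \ S) := rfl

theorem mul_apply_empty (f g : SetSeries ι R) : (f * g) ∅ = f ∅ * g ∅ := by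
  rw [mul_apply, powerset_empty, sum_singleton, sdiff_empty]

protected theorem mul_comm (f g : SetSeries ι R) : f * g = g * f := by
  ext Δ
  refine sum_bij' (fun S _ => Δ \ S) (fun S _ => Δ \ S) ?_ ?_ ?_ ?_ fun S hS => ?_
  iterate 2 exact fun S _ => mem_powerset.2 sdiff_subset
  iterate 2 exact fun S hS => Finset.sdiff_sdiff_eq_self (mem_powerset.1 hS)
  rw [Finset.sdiff_sdiff_eq_self (mem_powerset.1 hS), mul_comm]

protected theorem mul_assoc (f g h : SetSeries ι R) : f * g * h = f * (g * h) := by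
  ext Δ
  simp only [mul_apply, sum_mul, mul_sum]
  rw [sum_sigma', sum_sigma']
  refine sum_bij' (fun p _ => ⟨p.2, p.1 \ p.2⟩) (fun p _ => ⟨p.1 ∪ p.2, p.1⟩) ?_ ?_ ?_ ?_ ?_ <;>
    rintro ⟨S, T⟩ hp <;> simp only [mem_sigma, mem_powerset] at hp
  · simp only [mem_sigma, mem_powerset]
    exact ⟨hp.2.trans hp.1, sdiff_subset_sdiff hp.1 le_rfl⟩
  · simp only [mem_sigma, mem_powerset]
    exact ⟨union_subset hp.1 (hp.2.trans sdiff_subset), subset_union_left⟩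
  · simp only [union_sdiff_of_subset hp.2]
  · have hTS : Disjoint T S := (disjoint_sdiff.mono_right hp.2).symm
    simp only [union_sdiff_left, hTS.sdiff_eq_left]
  · have hST : (Δ \ T) \ (S \ T) = Δ \ S := by
      rw [sdiff_sdiff_left, sup_eq_union, union_sdiff_of_subset hp.2]
    simp only [hST, mul_assoc]

protected theorem one_mul (f : SetSeries ι R) : 1 * f = f := by
  ext Δ
  rw [mul_apply, sum_eq_single ∅]
  · rw [one_apply, if_pos rfl, one_mul, sdiff_empty]
  · intro S _ hS
    rw [one_apply, if_neg hS, zero_mul]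
  · exact fun h => absurd (empty_mem_powerset Δ) h

protected theorem mul_add (f g h : SetSeries ι R) : f * (g + h) = f * g + f * h := by
  ext Δ
  simp only [mul_apply, add_apply, mul_add, sum_add_distrib]

protected theorem mul_zero (f : SetSeries ι R) : f * 0 = 0 := by
  ext Δ
  simp only [mul_apply, zero_apply, mul_zero, sum_const_zero]

noncomputable instance : CommRing (SetSeries ι R) where
  __ := (inferInstance : AddCommGroup (SetSeries ι R))
  mul_assoc := SetSeries.mul_assoc
  mul_comm := SetSeries.mul_comm
  one_mul := SetSeries.one_mul
  mul_one f := by rw [SetSeries.mul_comm, SetSeries.one_mul]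
  left_distrib := SetSeries.mul_add
  right_distrib f g h := by
    rw [SetSeries.mul_comm, SetSeries.mul_add, SetSeries.mul_comm h, SetSeries.mul_comm h]
  zero_mul f := by rw [SetSeries.mul_comm, SetSeries.mul_zero]
  mul_zero := SetSeries.mul_zero

noncomputable instance [CommSemiring k] [Algebra k R] : Algebra k (SetSeries ι R) :=
  Algebra.ofModule
    (fun c f g => by
      ext Δ
      simp only [mul_apply, smul_apply, smul_mul_assoc, smul_sum])
    (fun c f g => by
      ext Δ
      simp only [mul_apply, smul_apply, mul_smul_comm, smul_sum])

theorem pow_apply_eq_zero {u : SetSeries ι R} (hu : u ∅ = 0) (n : ℕ) (Δ : Finset ι)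
    (hΔ : #Δ < n) : (u ^ n) Δ = 0 := by
  induction n generalizing Δ with
  | zero => exact absurd hΔ (Nat.not_lt_zero _)
  | succ n ih =>
    rw [pow_succ', mul_apply]
    refine sum_eq_zero fun S hS => ?_
    rcases S.eq_empty_or_nonempty with rfl | hne
    · rw [hu, zero_mul]
    · have hcard := card_sdiff_add_card_eq_card (mem_powerset.1 hS)
      have hpos := hne.card_pos
      rw [ih _ (by omega), mul_zero]

theorem isNilpotent_one_sub [Finite ι] {F : SetSeries ι R} (hF : F ∅ = 1) :
    IsNilpotent (1 - F) := by
  cases nonempty_fintype ι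
  refine ⟨Fintype.card ι + 1, ext fun Δ => pow_apply_eq_zero ?_ _ _ ?_⟩
  · rw [sub_apply, one_apply, if_pos rfl, hF, sub_self]
  · exact Nat.lt_succ_of_le Δ.card_le_univ

theorem isUnit_of_apply_empty [Finite ι] {F : SetSeries ι R} (hF : F ∅ = 1) : IsUnit F := by
  simpa only [sub_sub_cancel] using (isNilpotent_one_sub hF).isUnit_one_sub

/-- The derivation `t a * ∂ / ∂ (t a)`. -/
noncomputable def eulerDeriv (a : ι) : Derivation R (SetSeries ι R) (SetSeries ι R) :=
  Derivation.mk'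
    { toFun := fun f Δ => if a ∈ Δ then f Δ else 0
      map_add' := fun f g => by
        ext Δ
        change ite _ (f Δ + g Δ) 0 = ite _ (f Δ) 0 + ite _ (g Δ) 0
        rw [← ite_add_zero]
      map_smul' := fun c f => by
        ext Δ
        exact (smul_ite_zero (a ∈ Δ) c (f Δ)).symm }
    fun f g => by
      ext Δ
      rw [smul_eq_mul, smul_eq_mul, add_apply, SetSeries.mul_comm g]
      change ite (a ∈ Δ) (∑ S ∈ Δ.powerset, f S * g (Δ \ S)) 0 =
        ∑ S ∈ Δ.powerset, f S * ite (a ∈ Δ \ S) (g (Δ \ S)) 0 +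
          ∑ S ∈ Δ.powerset, ite (a ∈ S) (f S) 0 * g (Δ \ S)
      rw [← sum_add_distrib, ite_sum_zero]
      refine sum_congr rfl fun S hS => ?_
      have hSΔ : a ∈ S → a ∈ Δ := fun h => mem_powerset.1 hS h
      by_cases haS : a ∈ S <;> by_cases ha : a ∈ Δ <;> simp_all

theorem eulerDeriv_apply (a : ι) (f : SetSeries ι R) (Δ : Finset ι) :
    eulerDeriv a f Δ = if a ∈ Δ then f Δ else 0 := rfl

/-- The extension of a derivation of the coefficients to series. -/
noncomputable def mapDerivation [CommSemiring k] [Algebra k R] (d : Derivation k R R) :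
    Derivation k (SetSeries ι R) (SetSeries ι R) :=
  Derivation.mk' ((d : R →ₗ[k] R).compLeft (Finset ι)) fun f g => by
    ext Δ
    rw [smul_eq_mul, smul_eq_mul, add_apply, SetSeries.mul_comm g]
    change d (∑ S ∈ Δ.powerset, f S * g (Δ \ S)) =
      ∑ S ∈ Δ.powerset, f S * d (g (Δ \ S)) + ∑ S ∈ Δ.powerset, d (f S) * g (Δ \ S)
    rw [map_sum, ← sum_add_distrib]
    refine sum_congr rfl fun S _ => ?_
    rw [d.leibniz, smul_eq_mul, smul_eq_mul, mul_comm (g _)]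

/-- Discards all monomials that involve a variable outside `T`. -/
noncomputable def restrict (T : Finset ι) : SetSeries ι R →+* SetSeries ι R where
  toFun f Δ := if Δ ⊆ T then f Δ else 0
  map_one' := by
    ext Δ
    change ite (Δ ⊆ T) (ite (Δ = ∅) 1 0) 0 = ite (Δ = ∅) 1 0
    rcases eq_or_ne Δ ∅ with rfl | hΔ
    · rw [if_pos (empty_subset T)]
    · rw [if_neg hΔ, ite_self]
  map_zero' := by
    ext Δ
    exact ite_self 0
  map_add' f g := by
    ext Δ
    change ite _ (f Δ + g Δ) 0 = ite _ (f Δ) 0 + ite _ (g Δ) 0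
    rw [← ite_add_zero]
  map_mul' f g := by
    ext Δ
    change ite (Δ ⊆ T) (∑ S ∈ Δ.powerset, f S * g (Δ \ S)) 0 =
      ∑ S ∈ Δ.powerset, ite (S ⊆ T) (f S) 0 * ite (Δ \ S ⊆ T) (g (Δ \ S)) 0
    rw [ite_sum_zero]
    refine sum_congr rfl fun S hS => ?_
    have hsub : Δ ⊆ T ↔ S ⊆ T ∧ Δ \ S ⊆ T := by
      rw [← union_subset_iff, union_sdiff_of_subset (mem_powerset.1 hS)]
    simp only [hsub, ite_zero_mul_ite_zero]

theorem restrict_apply (T : Finset ι) (f : SetSeries ι R) (Δ : Finset ι) :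
    restrict T f Δ = if Δ ⊆ T then f Δ else 0 := rfl

theorem restrict_mul_restrict_compl_apply [Fintype ι] (T : Finset ι) (f g : SetSeries ι R)
    (Δ : Finset ι) : (restrict T f * restrict Tᶜ g) Δ = f (Δ ∩ T) * g (Δ \ T) := by
  rw [mul_apply, sum_eq_single (Δ ∩ T)]
  · rw [restrict_apply, if_pos inter_subset_right, sdiff_inter_self_left, restrict_apply, if_pos]
    exact fun x hx => mem_compl.2 (mem_sdiff.1 hx).2
  · intro S hS hne
    rw [restrict_apply, restrict_apply]
    by_cases hST : S ⊆ T
    · have hcompl : ¬ Δ \ S ⊆ Tᶜ := fun h => hne <| (subset_inter (mem_powerset.1 hS) hST).antisymm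
        fun x hx => by_contra fun hxS => mem_compl.1
          (h (mem_sdiff.2 ⟨(mem_inter.1 hx).1, hxS⟩)) (mem_inter.1 hx).2
      rw [if_neg hcompl, mul_zero]
    · rw [if_neg hST, zero_mul]
  · exact fun h => absurd (mem_powerset.2 inter_subset_left) h

theorem eulerDeriv_restrict (a : ι) (T : Finset ι) (f : SetSeries ι R) :
    eulerDeriv a (restrict T f) = restrict T (eulerDeriv a f) := by
  ext Δ
  simp only [eulerDeriv_apply, restrict_apply, ← ite_and, and_comm]

theorem eulerDeriv_restrict_eq_zero {a : ι} {T : Finset ι} (ha : a ∉ T) (f : SetSeries ι R) :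
    eulerDeriv a (restrict T f) = 0 := by
  ext Δ
  rw [eulerDeriv_apply, restrict_apply, zero_apply, ite_eq_right_iff, ite_eq_right_iff]
  exact fun haΔ hΔ => absurd (hΔ haΔ) ha

section UnipotentLog

variable [Algebra ℚ R] {F : SetSeries ι R}

theorem pow_dvd_unipotentLog_apply {x : R} {K : Finset ι → ℕ} (hK : K ∅ = 0)
    (hunion : ∀ S T, K (S ∪ T) ≤ K S + K T) (hF : ∀ Δ, x ^ K Δ ∣ F Δ) (Δ : Finset ι) :
    x ^ K Δ ∣ unipotentLog F Δ := by
  let B : Subalgebra ℚ (SetSeries ι R) :=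
    { carrier := {f | ∀ Δ, x ^ K Δ ∣ f Δ}
      mul_mem' := fun {f g} hf hg Δ => dvd_sum fun S hS =>
        calc x ^ K Δ ∣ x ^ (K S + K (Δ \ S)) := pow_dvd_pow x <| by
              simpa only [union_sdiff_of_subset (mem_powerset.1 hS)] using hunion S (Δ \ S)
          _ = x ^ K S * x ^ K (Δ \ S) := pow_add x _ _
          _ ∣ f S * g (Δ \ S) := mul_dvd_mul (hf S) (hg _)
      add_mem' := fun hf hg Δ => dvd_add (hf Δ) (hg Δ)
      algebraMap_mem' := fun c Δ => by
        rw [Algebra.algebraMap_eq_smul_one, smul_apply, one_apply]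
        split_ifs with h
        · rw [h, hK, pow_zero]
          exact one_dvd _
        · rw [smul_zero]
          exact dvd_zero _ }
  exact unipotentLog_mem (B := B) hF Δ

theorem unipotentLog_apply_empty (hF : F ∅ = 1) : unipotentLog F ∅ = 0 := by
  have hpow (n : ℕ) : ((1 - F) ^ (n + 1)) ∅ = 0 :=
    pow_apply_eq_zero (by rw [sub_apply, one_apply, if_pos rfl, hF, sub_self]) _ _ n.succ_pos
  change -(∑ n ∈ range _, ((n + 1 : ℚ)⁻¹) • (1 - F) ^ (n + 1)) ∅ = 0
  rw [sum_apply, neg_eq_zero]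
  exact sum_eq_zero fun n _ => by rw [smul_apply, hpow, smul_zero]

variable [Finite ι]

theorem eulerDeriv_unipotentLog (hF : F ∅ = 1) (a : ι) :
    eulerDeriv a F = F * eulerDeriv a (unipotentLog F) :=
  derivation_apply_eq_mul_unipotentLog _ (isNilpotent_one_sub hF)

theorem apply_eq_unipotentLog_apply (hF : F ∅ = 1) {L : SetSeries ι R} {a : ι}
    (hL : eulerDeriv a F = F * eulerDeriv a L) {Δ : Finset ι} (ha : a ∈ Δ) :
    L Δ = unipotentLog F Δ := by
  have h : eulerDeriv a L = eulerDeriv a (unipotentLog F) :=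
    (isUnit_of_apply_empty hF).mul_left_cancel (hL.symm.trans (eulerDeriv_unipotentLog hF a))
  simpa only [eulerDeriv_apply, if_pos ha] using congrFun h Δ

omit [Finite ι] in
theorem unipotentLog_apply_eq_zero [Fintype ι] (hF : F ∅ = 1) {T : Finset ι}
    (hT : F = restrict T F * restrict Tᶜ F) {Δ : Finset ι} {a : ι} (haΔ : a ∈ Δ) (haT : a ∈ T)
    (hΔ : ¬ Δ ⊆ T) : unipotentLog F Δ = 0 := by
  have hL : eulerDeriv a F = F * eulerDeriv a (restrict T (unipotentLog F)) := by
    calc eulerDeriv a F = restrict Tᶜ F * restrict T (eulerDeriv a F) := by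
          conv_lhs => rw [hT]
          rw [Derivation.leibniz, eulerDeriv_restrict_eq_zero (by simpa using haT), smul_zero,
            zero_add, smul_eq_mul, eulerDeriv_restrict]
      _ = F * eulerDeriv a (restrict T (unipotentLog F)) := by
          rw [eulerDeriv_unipotentLog hF, map_mul, eulerDeriv_restrict, ← mul_assoc,
            mul_comm (restrict Tᶜ F), ← hT]
  rw [← apply_eq_unipotentLog_apply hF hL haΔ, restrict_apply, if_neg hΔ]

theorem unipotentLog_apply_eq_zero_of_factors {β : Type*} [DecidableEq β] {comp : ι → β}
    (hF : F ∅ = 1)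
    (hfac : ∀ S T, Disjoint (S.image comp) (T.image comp) → F (S ∪ T) = F S * F T)
    {B : Finset ι} {a b : ι} (ha : a ∈ B) (hb : b ∈ B) (hab : comp a ≠ comp b) :
    unipotentLog F B = 0 := by
  cases nonempty_fintype ι
  let T : Finset ι := {x | comp x = comp a}
  have hsplit : F = restrict T F * restrict Tᶜ F := by
    ext Δ
    have hdisj : Disjoint ((Δ ∩ T).image comp) ((Δ \ T).image comp) := by
      simp only [T, disjoint_left, mem_image, mem_inter, mem_sdiff, mem_filter_univ]
      rintro _ ⟨x, ⟨-, hx⟩, rfl⟩ ⟨y, ⟨-, hy⟩, hxy⟩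
      exact hy (hxy.trans hx)
    rw [restrict_mul_restrict_compl_apply, ← hfac _ _ hdisj, union_comm, sdiff_union_inter]
  refine unipotentLog_apply_eq_zero hF hsplit ha (mem_filter_univ _ |>.2 rfl) fun hB => ?_
  exact hab (mem_filter_univ _ |>.1 (hB hb)).symm

end UnipotentLog

/-- The monomial `∏ h ∈ B, t h`. -/
noncomputable def monomial (B : Finset ι) : SetSeries ι R := fun Δ => if Δ = B then 1 else 0

theorem monomial_mul_apply (B : Finset ι) (f : SetSeries ι R) (Δ : Finset ι) :
    (monomial B * f : SetSeries ι R) Δ = if B ⊆ Δ then f (Δ \ B) else 0 := by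
  have hmul (S : Finset ι) : monomial B S * f (Δ \ S) = if S = B then f (Δ \ B) else 0 := by
    rw [monomial]
    split_ifs with h
    · rw [one_mul, h]
    · rw [zero_mul]
  rw [mul_apply, sum_congr rfl fun S _ => hmul S, sum_ite_eq']
  simp only [mem_powerset]

theorem sum_smul_monomial [Fintype ι] (f : SetSeries ι R) : ∑ B, f B • monomial B = f := by
  ext Δ
  rw [sum_apply, sum_eq_single Δ]
  · simp [smul_apply, monomial]
  · intro B _ hB
    simp [smul_apply, monomial, hB.symm]
  · simp

end Ring

section MapLinear

variable {S : Type*} [CommRing k] [CommRing R] [CommRing S] [Module k R] [Module k S]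

/-- A linear map applied to every coefficient. -/
noncomputable def mapLinear (φ : R →ₗ[k] S) : SetSeries ι R →ₗ[k] SetSeries ι S :=
  φ.compLeft (Finset ι)

theorem mapLinear_apply (φ : R →ₗ[k] S) (f : SetSeries ι R) (Δ : Finset ι) :
    mapLinear φ f Δ = φ (f Δ) := rfl

theorem mapLinear_monomial_mul [DecidableEq ι] (φ : R →ₗ[k] S) (B : Finset ι)
    (f : SetSeries ι R) : mapLinear φ (monomial B * f) = monomial B * mapLinear φ f := by
  ext Δ
  rw [mapLinear_apply, monomial_mul_apply, monomial_mul_apply, apply_ite φ, map_zero,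
    mapLinear_apply]

theorem mapLinear_eulerDeriv [DecidableEq ι] (φ : R →ₗ[k] S) (a : ι) (f : SetSeries ι R) :
    mapLinear φ (eulerDeriv a f) = eulerDeriv a (mapLinear φ f) := by
  ext Δ
  rw [mapLinear_apply, eulerDeriv_apply, eulerDeriv_apply, apply_ite φ, map_zero, mapLinear_apply]

theorem mapLinear_smul_mul [DecidableEq ι] [Fintype ι] (φ : R →ₗ[k] S) (p : R)
    (f g : SetSeries ι R) :
    mapLinear φ (p • (f * g)) = ∑ B, monomial B * mapLinear φ ((p * g B) • f) := by
  have hexpand : p • (f * g) = ∑ B, monomial B * ((p * g B) • f) := by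
    conv_lhs => rw [← sum_smul_monomial g]
    rw [mul_sum, smul_sum]
    refine sum_congr rfl fun B _ => ?_
    rw [mul_smul_comm, smul_smul, mul_smul_comm, mul_comm f]
  rw [hexpand, map_sum]
  exact sum_congr rfl fun B _ => mapLinear_monomial_mul φ B _

end MapLinear

end SetSeries

section EwensFunctional

open Polynomial Filter Asymptotics

/-- The probability `1 / ((N + θ - 1) ⋯ (N + θ - k))` that an Ewens permutation of `N` points
extends a given injection between sets of `k` points whose arrows do not close a cycle. -/
noncomputable def ewensMoment (θ : ℝ) (N k : ℕ) : ℝ :=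
  ∏ i ∈ Finset.range k, ((N : ℝ) + θ - (i + 1))⁻¹

theorem ewensMoment_zero (θ : ℝ) (N : ℕ) : ewensMoment θ N 0 = 1 :=
  Finset.prod_range_zero _

theorem ewensMoment_succ (θ : ℝ) (N k : ℕ) :
    ewensMoment θ N (k + 1) = ewensMoment θ N k * ((N : ℝ) + θ - (k + 1))⁻¹ :=
  Finset.prod_range_succ _ _

theorem eventually_half_le_natCast_add (c : ℝ) : ∀ᶠ N : ℕ in atTop, (N : ℝ) / 2 < N + c := by
  filter_upwards [tendsto_natCast_atTop_atTop.eventually_gt_atTop (-2 * c)] with N hN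
  linarith

theorem eventually_shift_ne_zero (θ c : ℝ) : ∀ᶠ N : ℕ in atTop, (N : ℝ) + θ - c ≠ 0 := by
  filter_upwards [eventually_half_le_natCast_add (θ - c)] with N hN
  rw [add_sub_assoc]
  exact ne_of_gt (lt_of_le_of_lt (by positivity) hN)

theorem inv_shift_isBigO (θ c : ℝ) :
    (fun N : ℕ => ((N : ℝ) + θ - c)⁻¹) =O[atTop] fun N : ℕ => (N : ℝ)⁻¹ := by
  refine IsBigO.inv_rev ?_ ?_
  · refine IsBigO.of_bound 2 ?_
    filter_upwards [eventually_half_le_natCast_add (θ - c)] with N hN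
    rw [add_sub_assoc, Real.norm_natCast]
    linarith [Real.le_norm_self ((N : ℝ) + (θ - c))]
  · filter_upwards [eventually_gt_atTop 0] with N hN h0
    exact absurd h0 (by exact_mod_cast hN.ne')

theorem inv_pow_isBigO_inv_pow {m n : ℕ} (h : m ≤ n) :
    (fun N : ℕ => ((N : ℝ)⁻¹) ^ n) =O[atTop] fun N : ℕ => ((N : ℝ)⁻¹) ^ m :=
  IsBigO.of_norm_le fun N => by
    rw [norm_pow, norm_inv, Real.norm_natCast]
    exact pow_le_pow_of_le_one (by positivity) N.cast_inv_le_one h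

theorem ewensMoment_isBigO (θ : ℝ) (k : ℕ) :
    (fun N : ℕ => ewensMoment θ N k) =O[atTop] fun N : ℕ => ((N : ℝ)⁻¹) ^ k := by
  induction k with
  | zero => simpa only [ewensMoment_zero, pow_zero] using isBigO_refl _ _
  | succ k ih =>
    simp only [ewensMoment_succ, pow_succ]
    exact ih.mul (inv_shift_isBigO θ _)

/-- The linear functional on polynomials that sends `X ^ k` to `ewensMoment θ N k`. -/
noncomputable def ewensFunctional (θ : ℝ) (N : ℕ) : ℝ[X] →ₗ[ℝ] ℝ :=
  lsum fun k => ewensMoment θ N k • LinearMap.id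

theorem ewensFunctional_monomial (θ : ℝ) (N k : ℕ) (c : ℝ) :
    ewensFunctional θ N (monomial k c) = ewensMoment θ N k * c := by
  simp only [ewensFunctional, lsum_apply, LinearMap.smul_apply, LinearMap.id_apply,
    smul_eq_mul]
  exact Polynomial.sum_monomial_index c _ (mul_zero _)

theorem ewensFunctional_X_pow (θ : ℝ) (N k : ℕ) :
    ewensFunctional θ N (X ^ k) = ewensMoment θ N k := by
  rw [← monomial_one_right_eq_X_pow, ewensFunctional_monomial, mul_one]

theorem ewensFunctional_one (θ : ℝ) (N : ℕ) : ewensFunctional θ N 1 = 1 := by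
  rw [← pow_zero X, ewensFunctional_X_pow, ewensMoment_zero]

/-- Integration by parts: read on monomials, this is the recursion between consecutive
`ewensMoment`s. -/
theorem ewensFunctional_X_mul (θ : ℝ) (q : ℝ[X]) :
    ∀ᶠ N : ℕ in atTop, ((N : ℝ) + θ) * ewensFunctional θ N (X * q) =
      ewensFunctional θ N q + ewensFunctional θ N (X * derivative (X * q)) := by
  induction q using Polynomial.induction_on' with
  | add p q hp hq =>
    filter_upwards [hp, hq] with N h1 h2
    simp only [mul_add, map_add]
    linear_combination h1 + h2
  | monomial k c =>
    filter_upwards [eventually_shift_ne_zero θ (k + 1)] with N hN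
    have hsucc : ewensMoment θ N (k + 1) * ((N : ℝ) + θ - (k + 1)) = ewensMoment θ N k := by
      rw [ewensMoment_succ, mul_assoc, inv_mul_cancel₀ hN, mul_one]
    rw [X_mul_monomial, derivative_monomial, X_mul_monomial]
    simp only [ewensFunctional_monomial, Nat.add_sub_cancel]
    push_cast
    linear_combination c * hsucc

/-- The derivation `X * d / dX`. -/
noncomputable def eulerDerivation : Derivation ℝ ℝ[X] ℝ[X] := (X : ℝ[X]) • derivative'

theorem eulerDerivation_apply (p : ℝ[X]) : eulerDerivation p = X * derivative p := rfl

theorem X_pow_dvd_eulerDerivation {j : ℕ} {p : ℝ[X]} (h : X ^ j ∣ p) :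
    X ^ j ∣ eulerDerivation p := by
  obtain ⟨q, rfl⟩ := h
  have hX : X ^ j ∣ eulerDerivation (X ^ j) := by
    rw [eulerDerivation_apply, derivative_X_pow]
    rcases j with - | j
    · exact one_dvd _
    · exact ⟨C ((j + 1 : ℕ) : ℝ), by rw [Nat.add_sub_cancel]; ring⟩
  rw [Derivation.leibniz, smul_eq_mul, smul_eq_mul]
  exact dvd_add (dvd_mul_right _ _) (hX.mul_left q)

theorem ewensFunctional_X_pow_succ_mul (θ : ℝ) (k : ℕ) (q : ℝ[X]) :
    ∀ᶠ N : ℕ in atTop, ((N : ℝ) + θ - (k + 1)) * ewensFunctional θ N (X ^ (k + 1) * q) =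
      ewensFunctional θ N (X ^ k * q) + ewensFunctional θ N (X ^ (k + 1) * eulerDerivation q) := by
  filter_upwards [ewensFunctional_X_mul θ (X ^ k * q)] with N hN
  have hder : X * derivative (X ^ (k + 1) * q) =
      ((k : ℝ) + 1) • (X ^ (k + 1) * q) + X ^ (k + 1) * eulerDerivation q := by
    rw [derivative_mul, derivative_X_pow, Nat.add_sub_cancel, smul_eq_C_mul, eulerDerivation_apply]
    simp only [Nat.cast_add, Nat.cast_one, map_add, map_one]
    ring
  rw [← mul_assoc, ← pow_succ', hder, map_add, map_smul, smul_eq_mul] at hN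
  linear_combination hN

end EwensFunctional

namespace SetSeries

section Tilted

open Polynomial Filter Asymptotics

variable {ι : Type*} {θ : ℝ} {F : SetSeries ι ℝ[X]} {N : ℕ}

theorem mapLinear_ewensFunctional_apply_empty (hF : F ∅ = 1) :
    mapLinear (ewensFunctional θ N) F ∅ = 1 := by
  rw [mapLinear_apply, hF, ewensFunctional_one]

variable [DecidableEq ι]

/-- The expectation of a polynomial under the functional `ewensFunctional θ N` tilted by the
density `F`, a ratio of two series. -/
noncomputable def tilted (θ : ℝ) (F : SetSeries ι ℝ[X]) (N : ℕ) : ℝ[X] →ₗ[ℝ] SetSeries ι ℝ where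
  toFun p := mapLinear (ewensFunctional θ N) (p • F) *
    Ring.inverse (mapLinear (ewensFunctional θ N) F)
  map_add' p q := by rw [add_smul, map_add, add_mul]
  map_smul' c p := by
    have hsmul : (c • p) • F = c • p • F := ext fun Δ => smul_assoc c p (F Δ)
    rw [hsmul, map_smul, smul_mul_assoc, RingHom.id_apply]

theorem tilted_apply (p : ℝ[X]) : tilted θ F N p =
    mapLinear (ewensFunctional θ N) (p • F) *
      Ring.inverse (mapLinear (ewensFunctional θ N) F) := rfl

theorem tilted_isBigO_of_X_pow_dvd {Δ : Finset ι} {c j : ℕ} {p : ℝ[X]}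
    (h : ∀ k, (fun N => tilted θ F N (X ^ k) Δ) =O[atTop] fun N : ℕ => ((N : ℝ)⁻¹) ^ (k + c))
    (hp : X ^ j ∣ p) :
    (fun N => tilted θ F N p Δ) =O[atTop] fun N : ℕ => ((N : ℝ)⁻¹) ^ (j + c) := by
  obtain ⟨q, rfl⟩ := hp
  induction q using Polynomial.induction_on' with
  | add p q hp hq => simpa only [mul_add, map_add, add_apply] using hp.add hq
  | monomial n a =>
    have hmonomial : (X : ℝ[X]) ^ j * Polynomial.monomial n a = a • X ^ (j + n) := by
      rw [← C_mul_X_pow_eq_monomial, smul_eq_C_mul, pow_add]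
      ring
    simp only [hmonomial, map_smul, smul_apply, smul_eq_mul]
    exact ((h (j + n)).trans (inv_pow_isBigO_inv_pow (by omega))).const_mul_left a

section Finite

variable [Finite ι]

theorem tilted_one (hF : F ∅ = 1) : tilted θ F N 1 = 1 := by
  rw [tilted_apply, one_smul]
  exact Ring.mul_inverse_cancel _
    (isUnit_of_apply_empty (mapLinear_ewensFunctional_apply_empty hF))

theorem tilted_apply_empty (hF : F ∅ = 1) (p : ℝ[X]) :
    tilted θ F N p ∅ = ewensFunctional θ N p := by
  have hone := congrFun (tilted_one (θ := θ) (N := N) hF) ∅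
  rw [tilted_apply, one_smul, mul_apply_empty, mapLinear_ewensFunctional_apply_empty hF,
    one_mul, one_apply, if_pos rfl] at hone
  rw [tilted_apply, mul_apply_empty, hone, mul_one, mapLinear_apply, smul_apply, hF, smul_eq_mul,
    mul_one]

end Finite

section Fintype

variable [Fintype ι]

theorem mapLinear_smul_mul_mul_inverse (p : ℝ[X]) (G : SetSeries ι ℝ[X]) :
    mapLinear (ewensFunctional θ N) (p • (F * G)) *
      Ring.inverse (mapLinear (ewensFunctional θ N) F) =
      ∑ B, monomial B * tilted θ F N (p * G B) := by
  rw [mapLinear_smul_mul, Finset.sum_mul]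
  exact Finset.sum_congr rfl fun B _ => mul_assoc _ _ _

theorem tilted_X_pow_succ (hF : F ∅ = 1) (k : ℕ) :
    ∀ᶠ N : ℕ in atTop, ((N : ℝ) + θ - (k + 1)) • tilted θ F N (X ^ (k + 1)) =
      tilted θ F N (X ^ k) + ∑ B, monomial B *
        tilted θ F N (X ^ (k + 1) * eulerDerivation (unipotentLog F B)) := by
  filter_upwards [eventually_all.2 fun Δ => ewensFunctional_X_pow_succ_mul θ k (F Δ)] with N hN
  have hlog : mapDerivation eulerDerivation F =
      F * mapDerivation eulerDerivation (unipotentLog F) :=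
    derivation_apply_eq_mul_unipotentLog _ (isNilpotent_one_sub hF)
  have hparts : ((N : ℝ) + θ - (k + 1)) •
        mapLinear (ewensFunctional θ N) ((X : ℝ[X]) ^ (k + 1) • F) =
      mapLinear (ewensFunctional θ N) ((X : ℝ[X]) ^ k • F) +
        mapLinear (ewensFunctional θ N) ((X : ℝ[X]) ^ (k + 1) • mapDerivation eulerDerivation F) :=
    SetSeries.ext hN
  rw [tilted_apply, ← smul_mul_assoc, hparts, add_mul, hlog, mapLinear_smul_mul_mul_inverse]
  rfl

theorem unipotentLog_mapLinear_apply (hF : F ∅ = 1) {a : ι} {Δ : Finset ι} (ha : a ∈ Δ) :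
    unipotentLog (mapLinear (ewensFunctional θ N) F) Δ =
      ∑ B, (monomial B * tilted θ F N (eulerDeriv a (unipotentLog F) B) : SetSeries ι ℝ) Δ := by
  set M := mapLinear (ewensFunctional θ N) F
  have hM : M ∅ = 1 := mapLinear_ewensFunctional_apply_empty hF
  have hderiv : eulerDeriv a M =
      mapLinear (ewensFunctional θ N) ((1 : ℝ[X]) • (F * eulerDeriv a (unipotentLog F))) := by
    rw [one_smul, ← eulerDeriv_unipotentLog hF, mapLinear_eulerDeriv]
  have hlog : eulerDeriv a (unipotentLog M) =
      ∑ B, monomial B * tilted θ F N (eulerDeriv a (unipotentLog F) B) := by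
    refine (isUnit_of_apply_empty hM).mul_left_cancel ?_
    have hexpand := mapLinear_smul_mul_mul_inverse (θ := θ) (F := F) (N := N) 1
      (eulerDeriv a (unipotentLog F))
    simp only [one_mul] at hexpand
    rw [← eulerDeriv_unipotentLog hM, hderiv, ← hexpand, mul_comm M, mul_assoc,
      Ring.inverse_mul_cancel _ (isUnit_of_apply_empty hM), mul_one]
  rw [← sum_apply, ← hlog, eulerDeriv_apply, if_pos ha]

end Fintype

variable [Finite ι] {w : Finset ι → ℕ}

theorem tilted_X_pow_succ_isBigO (hF : F ∅ = 1)
    (hlog : ∀ B Δ, B ⊆ Δ → B.Nonempty → X ^ (w Δ - (w (Δ \ B) + 1)) ∣ unipotentLog F B)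
    {Δ : Finset ι} {k : ℕ}
    (hk : (fun N => tilted θ F N (X ^ k) Δ) =O[atTop] fun N : ℕ => ((N : ℝ)⁻¹) ^ (k + w Δ))
    (hssubset : ∀ Δ' ⊂ Δ, ∀ k, (fun N => tilted θ F N (X ^ k) Δ') =O[atTop]
      fun N : ℕ => ((N : ℝ)⁻¹) ^ (k + w Δ')) :
    (fun N => tilted θ F N (X ^ (k + 1)) Δ) =O[atTop]
      fun N : ℕ => ((N : ℝ)⁻¹) ^ (k + 1 + w Δ) := by
  cases nonempty_fintype ι
  have hterm (B : Finset ι) : (fun N => (monomial B * tilted θ F N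
      (X ^ (k + 1) * eulerDerivation (unipotentLog F B)) : SetSeries ι ℝ) Δ) =O[atTop]
      fun N : ℕ => ((N : ℝ)⁻¹) ^ (k + w Δ) := by
    simp only [monomial_mul_apply]
    by_cases hB : B ⊆ Δ
    · simp only [if_pos hB]
      rcases B.eq_empty_or_nonempty with rfl | hne
      · simp only [unipotentLog_apply_empty hF, map_zero, mul_zero, zero_apply]
        exact isBigO_zero _ _
      · have hdvd : X ^ (k + 1 + (w Δ - (w (Δ \ B) + 1))) ∣
            X ^ (k + 1) * eulerDerivation (unipotentLog F B) := by
          rw [pow_add]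
          exact mul_dvd_mul_left _ (X_pow_dvd_eulerDerivation (hlog B Δ hB hne))
        exact (tilted_isBigO_of_X_pow_dvd (hssubset _ (Finset.sdiff_ssubset hB hne)) hdvd).trans
          (inv_pow_isBigO_inv_pow (by omega))
    · simp only [if_neg hB]
      exact isBigO_zero _ _
  have hsum := (inv_shift_isBigO θ (k + 1)).mul
    (hk.add (IsBigO.fun_sum (s := Finset.univ) fun B _ => hterm B))
  refine hsum.congr' ?_ (.of_forall fun N => by ring)
  filter_upwards [tilted_X_pow_succ (θ := θ) hF k, eventually_shift_ne_zero θ (k + 1)] with N hN h0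
  rw [← sum_apply, ← add_apply, ← hN, smul_apply, smul_eq_mul, inv_mul_cancel_left₀ h0]

theorem tilted_X_pow_isBigO (hF : F ∅ = 1) (hw : w ∅ = 0)
    (hlog : ∀ B Δ, B ⊆ Δ → B.Nonempty → X ^ (w Δ - (w (Δ \ B) + 1)) ∣ unipotentLog F B)
    (Δ : Finset ι) (k : ℕ) : (fun N => tilted θ F N (X ^ k) Δ) =O[atTop]
      fun N : ℕ => ((N : ℝ)⁻¹) ^ (k + w Δ) := by
  induction Δ using Finset.strongInduction generalizing k with
  | H Δ ih =>
    rcases Δ.eq_empty_or_nonempty with rfl | hne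
    · simpa only [tilted_apply_empty hF, ewensFunctional_X_pow, hw, add_zero] using
        ewensMoment_isBigO θ k
    induction k with
    | zero =>
      simp only [pow_zero, tilted_one hF, one_apply, if_neg hne.ne_empty]
      exact isBigO_zero _ _
    | succ k hk => exact tilted_X_pow_succ_isBigO hF hlog hk ih

theorem unipotentLog_mapLinear_isBigO_of_dvd (hF : F ∅ = 1) (hw : w ∅ = 0)
    (hlog : ∀ B Δ, B ⊆ Δ → B.Nonempty → X ^ (w Δ - (w (Δ \ B) + 1)) ∣ unipotentLog F B)
    {Δ : Finset ι} (hΔ : Δ.Nonempty) :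
    (fun N => unipotentLog (mapLinear (ewensFunctional θ N) F) Δ) =O[atTop]
      fun N : ℕ => ((N : ℝ)⁻¹) ^ (w Δ - 1) := by
  cases nonempty_fintype ι
  obtain ⟨a, ha⟩ := hΔ
  simp only [unipotentLog_mapLinear_apply hF ha, monomial_mul_apply]
  refine IsBigO.fun_sum fun B _ => ?_
  by_cases hB : B ⊆ Δ ∧ a ∈ B
  · simp only [if_pos hB.1, eulerDeriv_apply, if_pos hB.2]
    exact (tilted_isBigO_of_X_pow_dvd (tilted_X_pow_isBigO hF hw hlog _)
      (hlog B Δ hB.1 ⟨a, hB.2⟩)).trans (inv_pow_isBigO_inv_pow (by omega))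
  · have hzero (N : ℕ) : (if B ⊆ Δ then
        tilted θ F N (eulerDeriv a (unipotentLog F) B) (Δ \ B) else 0) = 0 := by
      rw [ite_eq_right_iff]
      intro hBΔ
      rw [eulerDeriv_apply, if_neg fun haB => hB ⟨hBΔ, haB⟩, map_zero, zero_apply]
    simp only [hzero]
    exact isBigO_zero _ _

/-- Quasi-factorization: when the density factors over the fibres of `comp`, each fibre but one
gains a factor `1 / N` on top of the divisibility of the density by powers of `X`. -/
theorem unipotentLog_mapLinear_isBigO {β : Type*} [DecidableEq β] {comp : ι → β}
    {K : Finset ι → ℕ} (hF : F ∅ = 1) (hK : K ∅ = 0) (hunion : ∀ S T, K (S ∪ T) ≤ K S + K T)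
    (hfac : ∀ S T, Disjoint (S.image comp) (T.image comp) → F (S ∪ T) = F S * F T)
    (hdvd : ∀ Δ, X ^ K Δ ∣ F Δ) {Δ : Finset ι} (hΔ : Δ.Nonempty) :
    (fun N => unipotentLog (mapLinear (ewensFunctional θ N) F) Δ) =O[atTop]
      fun N : ℕ => ((N : ℝ)⁻¹) ^ (K Δ + (Δ.image comp).card - 1) := by
  refine unipotentLog_mapLinear_isBigO_of_dvd (w := fun Δ => K Δ + (Δ.image comp).card) hF
    (by rw [hK, Finset.image_empty, Finset.card_empty]) ?_ hΔ
  rintro B Δ hB ⟨b, hb⟩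
  by_cases hconst : ∀ x ∈ B, comp x = comp b
  · have hsub : K Δ ≤ K B + K (Δ \ B) := by
      simpa only [Finset.union_sdiff_of_subset hB] using hunion B (Δ \ B)
    have himage : Δ.image comp ⊆ insert (comp b) ((Δ \ B).image comp) := by
      rw [Finset.image_subset_iff]
      intro x hx
      by_cases hxB : x ∈ B
      · exact hconst x hxB ▸ Finset.mem_insert_self _ _
      · exact Finset.mem_insert_of_mem (Finset.mem_image_of_mem _ (Finset.mem_sdiff.2 ⟨hx, hxB⟩))
    have hcard := (Finset.card_le_card himage).trans (Finset.card_insert_le _ _)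
    exact (pow_dvd_pow X (by omega)).trans (pow_dvd_unipotentLog_apply hK hunion hdvd B)
  · push Not at hconst
    obtain ⟨a, ha, hab⟩ := hconst
    rw [unipotentLog_apply_eq_zero_of_factors hF hfac ha hb hab]
    exact dvd_zero _

end Tilted

end SetSeries

section Jets

open Finset SetSeries
open scoped ContDiff

variable {ι : Type*} [Fintype ι] [DecidableEq ι] {f g F : (ι → ℝ) → ℝ}

/-- The partial derivative in the direction of the `a`-th coordinate. -/
noncomputable def partialDeriv (a : ι) (f : (ι → ℝ) → ℝ) : (ι → ℝ) → ℝ :=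
  fun x => fderiv ℝ f x (Pi.single a 1)

theorem contDiff_partialDeriv (hf : ContDiff ℝ ∞ f) (a : ι) : ContDiff ℝ ∞ (partialDeriv a f) :=
  (hf.fderiv_right le_rfl).clm_apply contDiff_const

theorem partialDeriv_comm (hf : ContDiff ℝ ∞ f) (a b : ι) :
    partialDeriv a (partialDeriv b f) = partialDeriv b (partialDeriv a f) := by
  funext x
  have hdiff : Differentiable ℝ (fderiv ℝ f) :=
    (hf.fderiv_right (m := ∞) le_rfl).differentiable (by simp)
  have hsecond (c d : ι) : partialDeriv c (partialDeriv d f) x =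
      fderiv ℝ (fderiv ℝ f) x (Pi.single c 1) (Pi.single d 1) := by
    unfold partialDeriv
    rw [fderiv_clm_apply (hdiff x) (by fun_prop)]
    simp
  rw [hsecond, hsecond]
  refine (hf.contDiffAt.isSymmSndFDerivAt ?_) _ _
  rw [minSmoothness_of_isRCLikeNormedField]
  exact WithTop.coe_le_coe.2 (le_top : (2 : ℕ∞) ≤ ⊤)

theorem partialDeriv_mul (hf : ContDiff ℝ ∞ f) (hg : ContDiff ℝ ∞ g) (a : ι) :
    partialDeriv a (f * g) = partialDeriv a f * g + f * partialDeriv a g := by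
  funext x
  rw [partialDeriv, fderiv_mul (hf.differentiable (by simp) x) (hg.differentiable (by simp) x)]
  simp only [partialDeriv, _root_.add_apply, _root_.smul_apply, smul_eq_mul, Pi.add_apply,
    Pi.mul_apply]
  ring

theorem partialDeriv_sum {κ : Type*} (s : Finset κ) {f : κ → (ι → ℝ) → ℝ}
    (hf : ∀ k, ContDiff ℝ ∞ (f k)) (a : ι) :
    partialDeriv a (∑ k ∈ s, f k) = ∑ k ∈ s, partialDeriv a (f k) := by
  funext x
  rw [partialDeriv, fderiv_sum fun k _ => (hf k).differentiable (by simp) x]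
  simp [partialDeriv]

theorem partialDeriv_eq_mul_partialDeriv_log (hF : ContDiff ℝ ∞ F) (hpos : ∀ x, 0 < F x) (a : ι) :
    partialDeriv a F = F * partialDeriv a fun x => Real.log (F x) := by
  funext x
  rw [Pi.mul_apply, partialDeriv, partialDeriv,
    fderiv.log (hF.differentiable (by simp) x) (hpos x).ne', _root_.smul_apply, smul_eq_mul,
    mul_inv_cancel_left₀ (hpos x).ne']

/-- Iterated partial derivatives, the head of the list being the outermost derivative. -/
noncomputable def listDeriv (l : List ι) (f : (ι → ℝ) → ℝ) : (ι → ℝ) → ℝ :=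
  l.foldr partialDeriv f

theorem contDiff_listDeriv (hf : ContDiff ℝ ∞ f) (l : List ι) : ContDiff ℝ ∞ (listDeriv l f) := by
  induction l with
  | nil => exact hf
  | cons a l ih => exact contDiff_partialDeriv ih a

theorem listDeriv_perm (hf : ContDiff ℝ ∞ f) {l l' : List ι} (h : l.Perm l') :
    listDeriv l f = listDeriv l' f := by
  induction h with
  | nil => rfl
  | cons a _ ih => exact congrArg (partialDeriv a) ih
  | swap a b l => exact partialDeriv_comm (contDiff_listDeriv hf l) b a
  | trans _ _ h₁ h₂ => exact h₁.trans h₂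

theorem iteratedFDeriv_single (hf : ContDiff ℝ ∞ f) (n : ℕ) (m : Fin n → ι) (x : ι → ℝ) :
    iteratedFDeriv ℝ n f x (fun h => Pi.single (m h) 1) = listDeriv (List.ofFn m) f x := by
  induction n generalizing x with
  | zero => rw [iteratedFDeriv_zero_apply, List.ofFn_zero, listDeriv, List.foldr_nil]
  | succ n ih =>
    have hdiff : DifferentiableAt ℝ (iteratedFDeriv ℝ n f) x :=
      hf.differentiable_iteratedFDeriv (by exact_mod_cast WithTop.coe_lt_top n) x
    rw [iteratedFDeriv_succ_apply_left, ← fderiv_continuousMultilinear_apply_const_apply hdiff,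
      List.ofFn_succ]
    exact congrArg (fun u => fderiv ℝ u x (Pi.single (m 0) 1))
      (funext fun y => ih (fun i => m i.succ) y)

/-- The mixed partial derivative with respect to all variables in `Δ`. -/
noncomputable def setDeriv (Δ : Finset ι) (f : (ι → ℝ) → ℝ) : (ι → ℝ) → ℝ :=
  listDeriv Δ.toList f

theorem contDiff_setDeriv (hf : ContDiff ℝ ∞ f) (Δ : Finset ι) : ContDiff ℝ ∞ (setDeriv Δ f) :=
  contDiff_listDeriv hf _

omit [Fintype ι] in
theorem setDeriv_empty (f : (ι → ℝ) → ℝ) : setDeriv ∅ f = f := by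
  rw [setDeriv, toList_empty, listDeriv, List.foldr_nil]

theorem setDeriv_insert (hf : ContDiff ℝ ∞ f) {a : ι} {Δ : Finset ι} (ha : a ∉ Δ) :
    setDeriv (insert a Δ) f = partialDeriv a (setDeriv Δ f) :=
  listDeriv_perm hf (toList_insert ha)

theorem setDeriv_insert_eq_setDeriv_partialDeriv (hf : ContDiff ℝ ∞ f) {a : ι} {Δ : Finset ι}
    (ha : a ∉ Δ) : setDeriv (insert a Δ) f = setDeriv Δ (partialDeriv a f) := by
  rw [setDeriv, listDeriv_perm hf ((toList_insert ha).trans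
    (List.perm_append_singleton a Δ.toList).symm), listDeriv, List.foldr_append]
  rfl

theorem setDeriv_mul (hf : ContDiff ℝ ∞ f) (hg : ContDiff ℝ ∞ g) (Δ : Finset ι) :
    setDeriv Δ (f * g) = ∑ S ∈ Δ.powerset, setDeriv S f * setDeriv (Δ \ S) g := by
  induction Δ using Finset.induction_on with
  | empty => simp only [powerset_empty, sum_singleton, empty_sdiff, setDeriv_empty]
  | insert a Δ ha ih =>
    have hsmooth (S : Finset ι) : ContDiff ℝ ∞ (setDeriv S f * setDeriv (Δ \ S) g) :=
      (contDiff_setDeriv hf S).mul (contDiff_setDeriv hg _)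
    rw [setDeriv_insert (f := f * g) (hf.mul hg) ha, ih, partialDeriv_sum _ hsmooth,
      sum_powerset_insert ha, ← sum_add_distrib]
    refine sum_congr rfl fun S hS => ?_
    have haS : a ∉ S := fun h => ha (mem_powerset.1 hS h)
    rw [partialDeriv_mul (contDiff_setDeriv hf S) (contDiff_setDeriv hg _), setDeriv_insert hf haS,
      insert_sdiff_of_notMem _ haS, setDeriv_insert hg (fun h => ha (mem_sdiff.1 h).1),
      insert_sdiff_insert, sdiff_insert_of_notMem ha, add_comm]

/-- The multilinear part of the Taylor expansion at `0`. -/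
noncomputable def jet (f : (ι → ℝ) → ℝ) : SetSeries ι ℝ := fun Δ => setDeriv Δ f 0

theorem jet_mul (hf : ContDiff ℝ ∞ f) (hg : ContDiff ℝ ∞ g) : jet (f * g) = jet f * jet g := by
  ext Δ
  rw [jet, setDeriv_mul hf hg, Finset.sum_apply]
  rfl

theorem eulerDeriv_jet (hf : ContDiff ℝ ∞ f) (a : ι) :
    eulerDeriv a (jet f) = monomial {a} * jet (partialDeriv a f) := by
  ext Δ
  rw [eulerDeriv_apply, monomial_mul_apply]
  simp only [singleton_subset_iff]
  split_ifs with ha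
  · rw [sdiff_singleton_eq_erase, jet, jet,
      ← setDeriv_insert_eq_setDeriv_partialDeriv hf (notMem_erase a Δ), insert_erase ha]
  · rfl

theorem eulerDeriv_jet_eq_mul_log (hF : ContDiff ℝ ∞ F) (hpos : ∀ x, 0 < F x) (a : ι) :
    eulerDeriv a (jet F) = jet F * eulerDeriv a (jet fun x => Real.log (F x)) := by
  have hlog : ContDiff ℝ ∞ fun x => Real.log (F x) := hF.log fun x => (hpos x).ne'
  rw [eulerDeriv_jet hF, eulerDeriv_jet hlog, partialDeriv_eq_mul_partialDeriv_log hF hpos,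
    jet_mul hF (contDiff_partialDeriv hlog a), mul_left_comm]

theorem jet_univ {ℓ : ℕ} {f : (Fin ℓ → ℝ) → ℝ} (hf : ContDiff ℝ ∞ f) :
    jet f univ = iteratedFDeriv ℝ ℓ f 0 (fun h => Pi.single h 1) := by
  have hperm : (univ : Finset (Fin ℓ)).toList.Perm (List.ofFn id) := by
    rw [List.ofFn_id, List.perm_ext_iff_of_nodup (nodup_toList _) (List.nodup_finRange ℓ)]
    simp only [mem_toList, mem_univ, List.mem_finRange, implies_true]
  exact (congrFun (listDeriv_perm hf hperm) 0).trans (iteratedFDeriv_single hf ℓ id 0).symm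

/-- The moment generating function of random variables `X` on a finite weighted set. -/
noncomputable def expSum {α : Type*} [Fintype α] (w : α → ℝ) (X : ι → α → ℝ) (t : ι → ℝ) : ℝ :=
  ∑ p, w p * Real.exp (∑ h, t h * X h p)

variable {α : Type*} [Fintype α]

omit [DecidableEq ι] in
theorem contDiff_expSum (w : α → ℝ) (X : ι → α → ℝ) : ContDiff ℝ ∞ (expSum w X) := by
  unfold expSum
  fun_prop

omit [DecidableEq ι] in
theorem expSum_pos [Nonempty α] {w : α → ℝ} (hw : ∀ p, 0 < w p) (X : ι → α → ℝ) (t : ι → ℝ) :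
    0 < expSum w X t :=
  Finset.sum_pos (fun p _ => mul_pos (hw p) (Real.exp_pos _)) univ_nonempty

theorem partialDeriv_expSum (w : α → ℝ) (X : ι → α → ℝ) (a : ι) :
    partialDeriv a (expSum w X) = expSum (fun p => w p * X a p) X := by
  funext t
  have hderiv : HasFDerivAt (expSum w X) (∑ p, w p • (Real.exp (∑ h, t h * X h p) •
      ∑ h, X h p • (ContinuousLinearMap.proj h : (ι → ℝ) →L[ℝ] ℝ))) t :=
    HasFDerivAt.fun_sum fun p _ => (HasFDerivAt.exp (HasFDerivAt.fun_sum fun h _ =>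
      (hasFDerivAt_apply h t).mul_const _)).const_mul _
  rw [partialDeriv, hderiv.fderiv]
  simp only [expSum, _root_.sum_apply, _root_.smul_apply, ContinuousLinearMap.proj_apply,
    smul_eq_mul, Pi.single_apply, mul_ite, mul_one, mul_zero, sum_ite_eq', mem_univ, if_true]
  exact sum_congr rfl fun p _ => by ring

theorem jet_expSum (w : α → ℝ) (X : ι → α → ℝ) (Δ : Finset ι) :
    jet (expSum w X) Δ = ∑ p, w p * ∏ h ∈ Δ, X h p := by
  have hderiv : setDeriv Δ (expSum w X) = expSum (fun p => w p * ∏ h ∈ Δ, X h p) X := by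
    induction Δ using Finset.induction_on with
    | empty => simp only [setDeriv_empty, prod_empty, mul_one]
    | insert a Δ ha ih =>
      rw [setDeriv_insert (contDiff_expSum w X) ha, ih, partialDeriv_expSum]
      simp only [prod_insert ha, mul_assoc, mul_comm (X a _)]
  rw [jet, hderiv]
  simp only [expSum, Pi.zero_apply, zero_mul, sum_const_zero, Real.exp_zero, mul_one]

end Jets

section Cycles

open Equiv Finset

variable {α β γ : Type*}

/-- The set of cycles of a permutation, fixed points included. -/
abbrev Cycles (σ : Perm α) := Quotient (Perm.SameCycle.setoid σ)

namespace Cycles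

variable {σ : Perm α}

theorem mk_apply (x : α) : (⟦σ x⟧ : Cycles σ) = ⟦x⟧ :=
  Quotient.sound (Perm.sameCycle_apply_left.2 (Perm.SameCycle.refl σ x))

theorem apply_eq_of_sameCycle (f : α → γ) (hf : ∀ x, f (σ x) = f x) {x y : α}
    (hxy : σ.SameCycle x y) : f x = f y := by
  have hzpow (n : ℤ) : f ((σ ^ n) x) = f x := by
    induction n with
    | zero => rw [zpow_zero, Perm.one_apply]
    | succ n ih => rw [add_comm, zpow_one_add, Perm.mul_apply, hf, ih]
    | pred n ih => rw [← ih, ← hf, ← Perm.mul_apply, ← zpow_one_add, add_sub_cancel]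
  obtain ⟨n, rfl⟩ := hxy
  exact (hzpow n).symm

/-- The map on cycles induced by an invariant function. -/
def lift (f : α → γ) (hf : ∀ x, f (σ x) = f x) : Cycles σ → γ :=
  Quotient.lift f fun _ _ => apply_eq_of_sameCycle f hf

theorem card_permCongr (e : α ≃ β) (σ : Perm α) :
    Nat.card (Cycles (e.permCongr σ)) = Nat.card (Cycles σ) := by
  refine (Nat.card_congr (Quotient.congr e fun x y => exists_congr fun n => ?_)).symm
  rw [← permCongrHom_coe, ← map_zpow, permCongrHom_coe, permCongr_apply, symm_apply_apply,
    e.injective.eq_iff]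

end Cycles

section Partition

variable [Fintype α] [DecidableEq α]

/-- A label common to exactly the points of one cycle: the cyclic factor of `σ` that moves the
point, or the point itself when it is fixed. -/
def cycleLabel (σ : Perm α) (x : α) : Perm α ⊕ α :=
  if σ x = x then Sum.inr x else Sum.inl (σ.cycleOf x)

theorem cycleLabel_eq_iff {σ : Perm α} {x y : α} :
    cycleLabel σ x = cycleLabel σ y ↔ σ.SameCycle x y := by
  by_cases hx : σ x = x <;> by_cases hy : σ y = y <;>
    simp only [cycleLabel, hx, hy, if_true, if_false]
  · rw [Sum.inr.injEq]
    exact ⟨fun h => h ▸ Perm.SameCycle.refl _ _, fun h => h.eq_of_left hx⟩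
  · simp only [reduceCtorEq, false_iff]
    exact fun h => hy (h.eq_of_left hx ▸ hx)
  · simp only [reduceCtorEq, false_iff]
    exact fun h => hx (h.eq_of_right hy ▸ hy)
  · rw [Sum.inl.injEq, ← Perm.sameCycle_iff_cycleOf_eq_of_mem_support (Perm.mem_support.2 hx)
      (Perm.mem_support.2 hy)]

theorem image_cycleLabel (σ : Perm α) :
    univ.image (cycleLabel σ) = σ.cycleFactorsFinset.disjSum σ.supportᶜ := by
  ext z
  simp only [mem_image, mem_univ, true_and, mem_disjSum]
  constructor
  · rintro ⟨x, rfl⟩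
    by_cases hx : σ x = x
    · exact .inr ⟨x, by simpa using hx, by rw [cycleLabel, if_pos hx]⟩
    · exact .inl ⟨σ.cycleOf x, Perm.cycleOf_mem_cycleFactorsFinset_iff.2 (Perm.mem_support.2 hx),
        by rw [cycleLabel, if_neg hx]⟩
  · rintro (⟨c, hc, rfl⟩ | ⟨x, hx, rfl⟩)
    · obtain ⟨x, hx⟩ := (Perm.mem_cycleFactorsFinset_iff.1 hc).1.nonempty_support
      have hxσ : σ x ≠ x := Perm.mem_support.1 (Perm.mem_cycleFactorsFinset_support_le hc hx)
      exact ⟨x, by rw [cycleLabel, if_neg hxσ, Perm.cycle_is_cycleOf hx hc]⟩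
    · exact ⟨x, by rw [cycleLabel, if_pos (by simpa using hx)]⟩

theorem card_parts_partition (σ : Perm α) : σ.partition.parts.card = Nat.card (Cycles σ) := by
  have hker : Perm.SameCycle.setoid σ = Setoid.ker (cycleLabel σ) := by
    ext x y
    exact cycleLabel_eq_iff.symm
  have hcard : Nat.card (Cycles σ) = #(univ.image (cycleLabel σ)) := by
    rw [Cycles, hker, Nat.card_congr (Setoid.quotientKerEquivRange _), Nat.card_eq_fintype_card,
      ← Set.toFinset_card, Set.toFinset_range]
  rw [hcard, image_cycleLabel, card_disjSum, Perm.parts_partition, Multiset.card_add,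
    Multiset.card_replicate, card_compl, Perm.cycleType_def, Multiset.card_map, ← Finset.card_def]

end Partition

section DecomposeOption

variable [DecidableEq β] (i : Option β) (σ : Perm β)

theorem decomposeOption_symm_apply_none : Perm.decomposeOption.symm (i, σ) none = i := by
  rw [Perm.decomposeOption_symm_apply, Perm.mul_apply, optionCongr_apply, Option.map_none,
    swap_apply_left]

theorem decomposeOption_symm_apply_some {x : β} (hx : some (σ x) ≠ i) :
    Perm.decomposeOption.symm (i, σ) (some x) = some (σ x) := by
  rw [Perm.decomposeOption_symm_apply, Perm.mul_apply, optionCongr_apply, Option.map_some,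
    swap_apply_of_ne_of_ne (Option.some_ne_none _) hx]

theorem decomposeOption_symm_apply_some_of_eq {x : β} (hx : some (σ x) = i) :
    Perm.decomposeOption.symm (i, σ) (some x) = none := by
  rw [Perm.decomposeOption_symm_apply, Perm.mul_apply, optionCongr_apply, Option.map_some, hx,
    swap_apply_right]

namespace Cycles

theorem mk_some_apply (x : β) : (⟦some (σ x)⟧ : Cycles (Perm.decomposeOption.symm (i, σ))) =
    ⟦some x⟧ := by
  by_cases hx : some (σ x) = i
  · rw [← mk_apply (some x), decomposeOption_symm_apply_some_of_eq i σ hx, ← mk_apply none,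
      decomposeOption_symm_apply_none, hx]
  · rw [← mk_apply (some x), decomposeOption_symm_apply_some i σ hx]

/-- Each cycle of `σ` lies in a cycle of the permutations obtained from `σ` by adding a point. -/
def mapSome : Cycles σ → Cycles (Perm.decomposeOption.symm (i, σ)) :=
  lift (fun x => ⟦some x⟧) (mk_some_apply i σ)

theorem card_decomposeOption_symm_none [Finite β] :
    Nat.card (Cycles (Perm.decomposeOption.symm (none, σ))) = Nat.card (Cycles σ) + 1 := by
  have hinvariant (z : Option β) :
      (Perm.decomposeOption.symm (none, σ) z).map (Quotient.mk (Perm.SameCycle.setoid σ)) =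
        z.map (Quotient.mk (Perm.SameCycle.setoid σ)) := by
    rcases z with - | x
    · rw [decomposeOption_symm_apply_none]
    · rw [decomposeOption_symm_apply_some _ _ (Option.some_ne_none _)]
      exact congrArg some (mk_apply x)
  rw [← Finite.card_option]
  refine Nat.card_congr ⟨lift _ hinvariant, fun q => q.elim ⟦none⟧ (mapSome none σ), ?_, ?_⟩
  · rintro ⟨- | x⟩ <;> rfl
  · rintro (- | q)
    · rfl
    · induction q using Quotient.inductionOn with | _ x => rfl

theorem card_decomposeOption_symm_some (b : β) :
    Nat.card (Cycles (Perm.decomposeOption.symm (some b, σ))) = Nat.card (Cycles σ) := by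
  have hinvariant (z : Option β) :
      (⟦(Perm.decomposeOption.symm (some b, σ) z).getD b⟧ : Cycles σ) = ⟦z.getD b⟧ := by
    rcases z with - | x
    · rw [decomposeOption_symm_apply_none, Option.getD_some, Option.getD_none]
    by_cases hx : some (σ x) = some b
    · rw [decomposeOption_symm_apply_some_of_eq _ _ hx, Option.getD_none, ← Option.some.inj hx]
      exact mk_apply x
    · rw [decomposeOption_symm_apply_some _ _ hx]
      exact mk_apply x
  refine Nat.card_congr
    ⟨lift (fun z => (⟦z.getD b⟧ : Cycles σ)) hinvariant, mapSome (some b) σ, ?_, ?_⟩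
  · rintro ⟨- | x⟩
    · refine Eq.trans ?_ (mk_apply none)
      rw [decomposeOption_symm_apply_none]
      rfl
    · rfl
  · rintro ⟨x⟩
    rfl

theorem card_decomposeOption_symm [Finite β] :
    Nat.card (Cycles (Perm.decomposeOption.symm (i, σ))) =
      Nat.card (Cycles σ) + if i = none then 1 else 0 := by
  rcases i with - | b
  · rw [card_decomposeOption_symm_none, if_pos rfl]
  · rw [card_decomposeOption_symm_some, if_neg (Option.some_ne_none b), add_zero]

end Cycles

end DecomposeOption

end Cycles

section ClosedCycles

variable {α γ : Type*}

/-- A list of pairs is the graph of an injection between its sets of first and second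
components. -/
structure IsPartialInjection (l : List (α × α)) : Prop where
  nodup_fst : (l.map Prod.fst).Nodup
  nodup_snd : (l.map Prod.snd).Nodup

namespace IsPartialInjection

variable {l l' : List (α × α)}

theorem ne_of_mem {p q : α × α} (h : IsPartialInjection (p :: l)) (hq : q ∈ l) :
    q.1 ≠ p.1 ∧ q.2 ≠ p.2 :=
  ⟨fun hqp => (List.nodup_cons.1 h.nodup_fst).1 (List.mem_map.2 ⟨q, hq, hqp⟩),
    fun hqp => (List.nodup_cons.1 h.nodup_snd).1 (List.mem_map.2 ⟨q, hq, hqp⟩)⟩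

theorem map {f : α → γ} (hf : Function.Injective f) (h : IsPartialInjection l) :
    IsPartialInjection (l.map (Prod.map f f)) where
  nodup_fst := by
    rw [List.map_map, Prod.map_fst', ← List.map_map]
    exact h.nodup_fst.map hf
  nodup_snd := by
    rw [List.map_map, Prod.map_snd', ← List.map_map]
    exact h.nodup_snd.map hf

theorem of_map {f : α → γ} (h : IsPartialInjection (l.map (Prod.map f f))) :
    IsPartialInjection l where
  nodup_fst := by
    have hfst := h.nodup_fst
    rw [List.map_map, Prod.map_fst', ← List.map_map] at hfst
    exact hfst.of_map f
  nodup_snd := by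
    have hsnd := h.nodup_snd
    rw [List.map_map, Prod.map_snd', ← List.map_map] at hsnd
    exact hsnd.of_map f

theorem perm (hl : l.Perm l') : IsPartialInjection l ↔ IsPartialInjection l' :=
  ⟨fun h => ⟨(hl.map _).nodup_iff.1 h.1, (hl.map _).nodup_iff.1 h.2⟩,
    fun h => ⟨(hl.map _).nodup_iff.2 h.1, (hl.map _).nodup_iff.2 h.2⟩⟩

theorem append_iff (hfst : ∀ p ∈ l, ∀ q ∈ l', p.1 ≠ q.1) (hsnd : ∀ p ∈ l, ∀ q ∈ l', p.2 ≠ q.2) :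
    IsPartialInjection (l ++ l') ↔ IsPartialInjection l ∧ IsPartialInjection l' := by
  have hmap (f : α × α → α) (hf : ∀ p ∈ l, ∀ q ∈ l', f p ≠ f q) :
      ((l ++ l').map f).Nodup ↔ (l.map f).Nodup ∧ (l'.map f).Nodup := by
    rw [List.map_append, List.nodup_append', ← and_assoc]
    rw [and_iff_left_iff_imp]
    intro _ z hz hz'
    obtain ⟨p, hp, rfl⟩ := List.mem_map.1 hz
    obtain ⟨q, hq, hqp⟩ := List.mem_map.1 hz'
    exact hf p hp q hq hqp.symm
  constructor
  · rintro ⟨h₁, h₂⟩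
    exact ⟨⟨((hmap _ hfst).1 h₁).1, ((hmap _ hsnd).1 h₂).1⟩,
      ⟨((hmap _ hfst).1 h₁).2, ((hmap _ hsnd).1 h₂).2⟩⟩
  · rintro ⟨h, h'⟩
    exact ⟨(hmap _ hfst).2 ⟨h.1, h'.1⟩, (hmap _ hsnd).2 ⟨h.2, h'.2⟩⟩

theorem of_graph {f : α → α} (hf : Function.Injective f) (hl : l.Nodup)
    (h : ∀ p ∈ l, f p.1 = p.2) : IsPartialInjection l where
  nodup_fst := hl.map_on fun p hp q hq hpq => Prod.ext hpq (by rw [← h p hp, ← h q hq, hpq])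
  nodup_snd := hl.map_on fun p hp q hq hpq =>
    Prod.ext (hf (by rw [h p hp, h q hq, hpq])) hpq

end IsPartialInjection

variable [DecidableEq α] [DecidableEq γ]

/-- Removal of `p.1` from the pairs of `l`: an arrow to `p.1` is extended to `p.2`. -/
def contract (p : α × α) (l : List (α × α)) : List (α × α) :=
  l.map fun q => (q.1, if q.2 = p.1 then p.2 else q.2)

theorem length_contract (p : α × α) (l : List (α × α)) : (contract p l).length = l.length :=
  List.length_map _

theorem IsPartialInjection.contract {p : α × α} {l : List (α × α)}
    (h : IsPartialInjection (p :: l)) : IsPartialInjection (contract p l) where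
  nodup_fst := by
    rw [_root_.contract, List.map_map]
    exact (List.nodup_cons.1 h.nodup_fst).2
  nodup_snd := by
    have hsnd := List.nodup_cons.1 h.nodup_snd
    have hmap : (_root_.contract p l).map Prod.snd =
        (l.map Prod.snd).map fun z => if z = p.1 then p.2 else z := by
      rw [_root_.contract, List.map_map, List.map_map]
      rfl
    rw [hmap]
    refine hsnd.2.map_on fun x hx y hy hxy => ?_
    have hxp : x ≠ p.2 := fun hxp => hsnd.1 (hxp ▸ hx)
    have hyp : y ≠ p.2 := fun hyp => hsnd.1 (hyp ▸ hy)
    split_ifs at hxy with hx₁ hy₁ hy₁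
    · exact hx₁.trans hy₁.symm
    · exact absurd hxy.symm hyp
    · exact absurd hxy hxp
    · exact hxy

/-- The number of cycles closed by a partial injection: contract its pairs one after the other, and
count the pairs that have become loops. -/
def closedCycles : List (α × α) → ℕ
  | [] => 0
  | p :: l => (if p.2 = p.1 then 1 else 0) + closedCycles (contract p l)
termination_by l => l.length
decreasing_by rw [length_contract]; exact Nat.lt_succ_self _

theorem closedCycles_nil : closedCycles ([] : List (α × α)) = 0 := by
  rw [closedCycles]

theorem closedCycles_cons (p : α × α) (l : List (α × α)) :
    closedCycles (p :: l) = (if p.2 = p.1 then 1 else 0) + closedCycles (contract p l) := by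
  rw [closedCycles]

theorem contract_map {f : α → γ} (hf : Function.Injective f) (p : α × α) (l : List (α × α)) :
    contract (p.map f f) (l.map (Prod.map f f)) = (contract p l).map (Prod.map f f) := by
  rw [contract, contract, List.map_map, List.map_map]
  refine List.map_congr_left fun q _ => ?_
  simp only [Function.comp_apply, Prod.map_fst, Prod.map_snd, hf.eq_iff, Prod.map_apply]
  rw [apply_ite f]

theorem closedCycles_map {f : α → γ} (hf : Function.Injective f) (l : List (α × α)) :
    closedCycles (l.map (Prod.map f f)) = closedCycles l := by
  induction l using closedCycles.induct with
  | case1 => rw [List.map_nil, closedCycles_nil, closedCycles_nil]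
  | case2 p l ih =>
    rw [List.map_cons, closedCycles_cons, closedCycles_cons, ← ih, contract_map hf]
    simp only [Prod.map_fst, Prod.map_snd, hf.eq_iff]

theorem closedCycles_le_length (l : List (α × α)) : closedCycles l ≤ l.length := by
  induction l using closedCycles.induct with
  | case1 => exact closedCycles_nil.le
  | case2 p l ih =>
    rw [length_contract] at ih
    rw [closedCycles_cons, List.length_cons]
    split_ifs <;> omega

theorem contract_append (p : α × α) (l l' : List (α × α)) :
    contract p (l ++ l') = contract p l ++ contract p l' :=
  List.map_append

theorem contract_eq_self {p : α × α} {l : List (α × α)} (h : ∀ q ∈ l, q.2 ≠ p.1) :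
    contract p l = l := by
  refine (List.map_congr_left fun q hq => ?_).trans (List.map_id _)
  rw [if_neg (h q hq)]
  rfl

theorem closedCycles_append {l l' : List (α × α)}
    (h : ∀ p ∈ l, ∀ q ∈ l', p.1 ≠ q.2 ∧ p.2 ≠ q.1) :
    closedCycles (l ++ l') = closedCycles l + closedCycles l' := by
  induction l using closedCycles.induct with
  | case1 => rw [List.nil_append, closedCycles_nil, zero_add]
  | case2 p l ih =>
    have hp := List.forall_mem_cons.1 h
    rw [List.cons_append, closedCycles_cons, closedCycles_cons, contract_append,
      contract_eq_self fun q hq => (hp.1 q hq).1.symm, ih, add_assoc]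
    rintro q hq q' hq'
    obtain ⟨z, hz, rfl⟩ := List.mem_map.1 hq
    refine ⟨(hp.2 z hz q' hq').1, ?_⟩
    dsimp only
    split_ifs
    · exact (hp.1 q' hq').2
    · exact (hp.2 z hz q' hq').2

end ClosedCycles

section EwensSum

open Equiv Finset

variable {R : Type*} [CommSemiring R]

/-- The total weight of the permutations that extend a list of pairs, a permutation being weighted
by `θ` to the number of its cycles. -/
noncomputable def ewensSum {α : Type*} [Fintype α] [DecidableEq α] (θ : R) (l : List (α × α)) : R :=
  ∑ σ : Perm α, if ∀ p ∈ l, σ p.1 = p.2 then θ ^ Nat.card (Cycles σ) else 0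

section Transport

variable {α γ : Type*} [Fintype α] [DecidableEq α] [Fintype γ] [DecidableEq γ]

theorem ewensSum_map (θ : R) (e : α ≃ γ) (l : List (α × α)) :
    ewensSum θ (l.map (Prod.map e e)) = ewensSum θ l := by
  refine (Fintype.sum_equiv e.permCongr _ _ fun σ => ?_).symm
  simp only [Cycles.card_permCongr, List.forall_mem_map, Prod.map_fst, Prod.map_snd,
    permCongr_apply, symm_apply_apply, e.injective.eq_iff]

theorem ewensSum_perm (θ : R) {l l' : List (α × α)} (h : l.Perm l') :
    ewensSum θ l = ewensSum θ l' := by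
  simp only [ewensSum, h.mem_iff]

end Transport

section Option

variable {β : Type*} [DecidableEq β]

theorem IsPartialInjection.exists_contract_eq_map_some {b : Option β}
    {l : List (Option β × Option β)} (h : IsPartialInjection ((none, b) :: l)) :
    ∃ l' : List (β × β), l'.map (Prod.map some some) = _root_.contract (none, b) l := by
  change _ ∈ Set.range (List.map (Prod.map some some))
  rw [Set.range_list_map]
  intro q hq
  obtain ⟨z, hz, rfl⟩ := List.mem_map.1 hq
  have hne := h.ne_of_mem hz
  have hsnd : (if z.2 = none then b else z.2) ≠ none := by
    split_ifs with hz₂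
    · exact hz₂ ▸ hne.2.symm
    · exact hz₂
  obtain ⟨x, hx⟩ := Option.ne_none_iff_exists.1 hne.1
  obtain ⟨y, hy⟩ := Option.ne_none_iff_exists.1 hsnd
  exact ⟨(x, y), Prod.ext hx hy⟩

theorem decomposeOption_symm_extends_iff {b : Option β} {l : List (Option β × Option β)}
    {l' : List (β × β)} (h : IsPartialInjection ((none, b) :: l))
    (hl' : l'.map (Prod.map some some) = contract (none, b) l) (σ : Perm β) :
    (∀ p ∈ (none, b) :: l, Perm.decomposeOption.symm (b, σ) p.1 = p.2) ↔
      ∀ p ∈ l', σ p.1 = p.2 := by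
  have hsome : (∀ p ∈ l', σ p.1 = p.2) ↔
      ∀ p ∈ l'.map (Prod.map some some), optionCongr σ p.1 = p.2 := by
    simp only [List.forall_mem_map, Prod.map_fst, Prod.map_snd, optionCongr_apply,
      Option.map_some, Option.some.injEq]
  rw [hsome, hl', contract, List.forall_mem_cons, List.forall_mem_map,
    decomposeOption_symm_apply_none, and_iff_right rfl]
  refine forall₂_congr fun p hp => ?_
  rw [Perm.decomposeOption_symm_apply, Perm.mul_apply, swap_apply_eq_iff]
  by_cases hpn : p.2 = none
  · rw [if_pos hpn, hpn, swap_apply_left]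
  · rw [if_neg hpn, swap_apply_of_ne_of_ne hpn (h.ne_of_mem hp).2]

variable [Fintype β]

theorem ewensSum_none_cons (θ : R) {b : Option β} {l : List (Option β × Option β)}
    {l' : List (β × β)} (h : IsPartialInjection ((none, b) :: l))
    (hl' : l'.map (Prod.map some some) = contract (none, b) l) :
    ewensSum θ ((none, b) :: l) = (if b = none then θ else 1) * ewensSum θ l' := by
  rw [ewensSum, ← Perm.decomposeOption.symm.sum_comp, Fintype.sum_prod_type,
    Fintype.sum_eq_single b]
  · simp only [decomposeOption_symm_extends_iff h hl', Cycles.card_decomposeOption_symm, ewensSum,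
      mul_sum, mul_ite, mul_zero]
    refine sum_congr rfl fun σ _ => if_congr Iff.rfl ?_ rfl
    split_ifs
    · exact pow_succ' _ _
    · rw [add_zero, one_mul]
  · intro c hc
    refine sum_eq_zero fun σ _ => if_neg fun hσ => hc ?_
    rw [← decomposeOption_symm_apply_none c σ]
    exact hσ _ List.mem_cons_self

theorem ewensSum_nil_option (θ : R) : ewensSum θ ([] : List (Option β × Option β)) =
    (θ + Fintype.card β) * ewensSum θ ([] : List (β × β)) := by
  rw [ewensSum, ← Perm.decomposeOption.symm.sum_comp, Fintype.sum_prod_type, Fintype.sum_option]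
  simp only [Cycles.card_decomposeOption_symm, ewensSum, List.not_mem_nil, IsEmpty.forall_iff,
    implies_true, if_true, reduceCtorEq, if_false, add_zero, sum_const, card_univ, pow_succ',
    ← mul_sum, nsmul_eq_mul, add_mul]

/-- Contract a pair of the list, relabelled so that it starts at `none`, or split off the image of
`none` when the list is empty. -/
theorem ewensSum_option_eq (θ : R) {l : List (Option β × Option β)} (hl : IsPartialInjection l)
    (hβ : ∀ l' : List (β × β), IsPartialInjection l' → ewensSum θ l' =
      θ ^ closedCycles l' * ∏ i ∈ range (Fintype.card β - l'.length), (θ + i)) :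
    ewensSum θ l =
      θ ^ closedCycles l * ∏ i ∈ range (Fintype.card (Option β) - l.length), (θ + i) := by
  rw [Fintype.card_option]
  rcases l with _ | ⟨⟨a, b⟩, l⟩
  · rw [ewensSum_nil_option, hβ [] ⟨List.nodup_nil, List.nodup_nil⟩]
    simp only [closedCycles_nil, List.length_nil, Nat.sub_zero, prod_range_succ]
    ring
  wlog ha : a = none generalizing a b l
  · let e : Perm (Option β) := swap a none
    have h := this (l.map (Prod.map e e)) (e a) (e b) (hl.map e.injective) (swap_apply_left _ _)
    rwa [show (e a, e b) :: l.map (Prod.map e e) = ((a, b) :: l).map (Prod.map e e) from rfl,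
      ewensSum_map, closedCycles_map e.injective, List.length_map] at h
  subst ha
  obtain ⟨l', hl'⟩ := hl.exists_contract_eq_map_some
  have hlen : l'.length = l.length := by
    rw [← length_contract (none, b) l, ← hl', List.length_map]
  have hIPI : IsPartialInjection l' := .of_map (f := some) (hl' ▸ hl.contract)
  rw [ewensSum_none_cons θ hl hl', hβ l' hIPI, closedCycles_cons, ← hl',
    closedCycles_map (Option.some_injective β), hlen, List.length_cons, Nat.add_sub_add_right,
    ← mul_assoc, pow_add, pow_ite, pow_one, pow_zero]

end Option

universe u

theorem ewensSum_eq (θ : R) {α : Type u} [Fintype α] [DecidableEq α] {l : List (α × α)}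
    (hl : IsPartialInjection l) : ewensSum θ l =
      θ ^ closedCycles l * ∏ i ∈ range (Fintype.card α - l.length), (θ + i) := by
  refine Finite.induction_empty_option (P := fun α => ∀ [Fintype α] [DecidableEq α]
    (l : List (α × α)), IsPartialInjection l → ewensSum θ l =
      θ ^ closedCycles l * ∏ i ∈ range (Fintype.card α - l.length), (θ + i)) ?_ ?_ ?_ α l hl
  · intro α γ e hα _ _ l hl
    classical
    let _ := Fintype.ofEquiv γ e.symm
    rw [← ewensSum_map θ e.symm, hα _ (hl.map e.symm.injective),
      closedCycles_map e.symm.injective, List.length_map, Fintype.card_congr e]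
  · intro _ _ l _
    obtain rfl : l = [] := Subsingleton.elim _ _
    simp [ewensSum, closedCycles_nil]
  · intro β _ hβ _ _ l hl
    classical
    convert ewensSum_option_eq θ hl hβ

variable {α : Type*} [DecidableEq α]

/-- Evaluate the Ewens weight at `θ = 2`: it does not depend on the order of the pairs and
determines the number of closed cycles. -/
theorem closedCycles_perm [Finite α] {l l' : List (α × α)} (h : l.Perm l')
    (hl : IsPartialInjection l) : closedCycles l = closedCycles l' := by
  cases nonempty_fintype α
  have hsum := ewensSum_perm 2 h
  rw [ewensSum_eq 2 hl, ewensSum_eq 2 ((IsPartialInjection.perm h).1 hl), h.length_eq] at hsum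
  refine Nat.pow_right_injective le_rfl (Nat.eq_of_mul_eq_mul_right ?_ hsum)
  exact prod_pos fun i _ => by positivity

end EwensSum

section PairPolynomial

open Polynomial Finset

universe u

variable {α : Type u} [DecidableEq α] (θ : ℝ) {S T : Finset (α × α)}

open Classical in
/-- The monomial `θ ^ c X ^ k` that records the number `c` of closed cycles and the number `k` of
pairs of a partial injection; it is `0` for a set of pairs that no permutation extends.
`ewensFunctional θ N` takes it to the probability that an Ewens permutation extends the pairs. -/
noncomputable def pairPolynomial (S : Finset (α × α)) : ℝ[X] :=
  if IsPartialInjection S.toList then monomial #S (θ ^ closedCycles S.toList) else 0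

theorem pairPolynomial_empty : pairPolynomial θ (∅ : Finset (α × α)) = 1 := by
  rw [pairPolynomial, toList_empty, if_pos ⟨List.nodup_nil, List.nodup_nil⟩, closedCycles_nil,
    card_empty, pow_zero, monomial_zero_one]

theorem X_pow_card_dvd_pairPolynomial (S : Finset (α × α)) : X ^ #S ∣ pairPolynomial θ S := by
  rw [pairPolynomial]
  split_ifs
  · exact ⟨C _, by rw [← C_mul_X_pow_eq_monomial, mul_comm]⟩
  · exact dvd_zero _

theorem exists_finite_pairPolynomial_mem (r : ℕ) : ∃ V : Set ℝ[X], V.Finite ∧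
    ∀ {α : Type u} [DecidableEq α] (S : Finset (α × α)), #S ≤ r → pairPolynomial θ S ∈ V := by
  refine ⟨insert 0 (Set.image2 (fun k c => monomial k (θ ^ c)) (Set.Iic r) (Set.Iic r)),
    (Set.Finite.image2 _ (Set.finite_Iic r) (Set.finite_Iic r)).insert 0, fun S hS => ?_⟩
  rw [pairPolynomial]
  split_ifs
  · refine Or.inr (Set.mem_image2_of_mem hS ((closedCycles_le_length _).trans ?_))
    rwa [length_toList]
  · exact Or.inl rfl

/-- No arrow of `S` shares an endpoint with an arrow of `T`. -/
def VertexDisjoint (S T : Finset (α × α)) : Prop :=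
  ∀ p ∈ S, ∀ q ∈ T, p.1 ≠ q.1 ∧ p.1 ≠ q.2 ∧ p.2 ≠ q.1 ∧ p.2 ≠ q.2

theorem pairPolynomial_union [Finite α] (hST : VertexDisjoint S T) :
    pairPolynomial θ (S ∪ T) = pairPolynomial θ S * pairPolynomial θ T := by
  have hdisj : Disjoint S T := disjoint_left.2 fun p hS hT => (hST p hS p hT).1 rfl
  have hperm : (S ∪ T).toList.Perm (S.toList ++ T.toList) := by
    rw [← disjUnion_eq_union S T hdisj, ← Multiset.coe_eq_coe, ← Multiset.coe_add]
    simp only [coe_toList, disjUnion_val]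
  simp only [VertexDisjoint, ← mem_toList (s := S), ← mem_toList (s := T)] at hST
  have hiff : IsPartialInjection (S ∪ T).toList ↔
      IsPartialInjection S.toList ∧ IsPartialInjection T.toList :=
    (IsPartialInjection.perm hperm).trans (IsPartialInjection.append_iff
      (fun p hp q hq => (hST p hp q hq).1) fun p hp q hq => (hST p hp q hq).2.2.2)
  by_cases h : IsPartialInjection (S ∪ T).toList
  · have hcycles : closedCycles (S ∪ T).toList =
        closedCycles S.toList + closedCycles T.toList := by
      rw [closedCycles_perm hperm h, closedCycles_append fun p hp q hq =>
        ⟨(hST p hp q hq).2.1, (hST p hp q hq).2.2.1⟩]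
    rw [pairPolynomial, pairPolynomial, pairPolynomial, if_pos h, if_pos (hiff.1 h).1,
      if_pos (hiff.1 h).2, monomial_mul_monomial, hcycles, card_union_of_disjoint hdisj, pow_add]
  · rw [pairPolynomial, pairPolynomial, pairPolynomial, if_neg h, ite_zero_mul_ite_zero,
      if_neg fun h' => h (hiff.2 h')]

variable {ι β : Type*} [DecidableEq ι] [DecidableEq β]

/-- The system of polynomials attached to the unions of a family of sets of pairs. -/
noncomputable def pairSeries (U : ι → Finset (α × α)) : SetSeries ι ℝ[X] :=
  fun Δ => pairPolynomial θ (Δ.biUnion U)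

omit [DecidableEq ι] in
theorem pairSeries_apply_empty (U : ι → Finset (α × α)) : pairSeries θ U ∅ = 1 :=
  pairPolynomial_empty θ

theorem unipotentLog_pairSeries_isBigO [Finite α] [Finite ι] (U : ι → Finset (α × α)) (comp : ι → β)
    (hU : ∀ h h', comp h ≠ comp h' → VertexDisjoint (U h) (U h')) {Δ : Finset ι} (hΔ : Δ.Nonempty) :
    (fun N => unipotentLog (SetSeries.mapLinear (ewensFunctional θ N) (pairSeries θ U)) Δ)
      =O[Filter.atTop] fun N : ℕ => ((N : ℝ)⁻¹) ^ (#(Δ.biUnion U) + #(Δ.image comp) - 1) := by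
  refine SetSeries.unipotentLog_mapLinear_isBigO (comp := comp) (K := fun Δ => #(Δ.biUnion U))
    (pairSeries_apply_empty θ U) card_empty (fun S T => ?_) (fun S T hST => ?_)
    (fun Δ => X_pow_card_dvd_pairPolynomial θ _) hΔ
  · rw [union_biUnion]
    exact card_union_le _ _
  · rw [pairSeries, union_biUnion]
    refine pairPolynomial_union θ fun p hp q hq => ?_
    obtain ⟨h, hh, hp⟩ := mem_biUnion.1 hp
    obtain ⟨h', hh', hq⟩ := mem_biUnion.1 hq
    exact hU h h' (disjoint_iff_ne.1 hST _ (mem_image_of_mem comp hh) _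
      (mem_image_of_mem comp hh')) p hp q hq

end PairPolynomial

section EwensMeasure

open Finset Equiv MeasureTheory

variable {θ : ℝ} {N : ℕ}

/-- The probability of a permutation under the Ewens measure. -/
noncomputable def ewensWeight (θ : ℝ) (σ : Perm (Fin N)) : ℝ :=
  θ ^ numCycles σ / ∏ k ∈ range N, (θ + k)

/-- The indicator that a map extends the pairs of `S`. -/
def extendsIndicator {α : Type*} [DecidableEq α] (S : Finset (α × α)) (f : α → α) : ℝ :=
  if ∀ p ∈ S, f p.1 = p.2 then 1 else 0

theorem prod_extendsIndicator {ι α : Type*} [DecidableEq α] (U : ι → Finset (α × α))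
    (Δ : Finset ι) (f : α → α) :
    ∏ h ∈ Δ, extendsIndicator (U h) f = extendsIndicator (Δ.biUnion U) f := by
  simp only [extendsIndicator, prod_boole]
  refine if_congr ?_ rfl rfl
  simp only [mem_biUnion]
  exact ⟨fun h p ⟨a, ha, hp⟩ => h a ha p hp, fun h a ha p hp => h p ⟨a, ha, hp⟩⟩

theorem prod_elemVar {ι Ω : Type*} (σ : Ω → Perm (Fin N)) (i s : ι → Fin N) (A : Finset ι)
    (ω : Ω) : ∏ j ∈ A, elemVar σ (i j) (s j) ω =
      extendsIndicator (A.image fun j => (i j, s j)) (σ ω) := by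
  simp only [elemVar, extendsIndicator, prod_boole, forall_mem_image]

theorem ewensWeight_pos (hθ : 0 < θ) (σ : Perm (Fin N)) : 0 < ewensWeight θ σ :=
  div_pos (pow_pos hθ _) (prod_pos fun k _ => by positivity)

theorem prod_range_sub_div_prod_range (hθ : 0 < θ) {k : ℕ} (hk : k ≤ N) :
    (∏ i ∈ range (N - k), (θ + i)) / ∏ i ∈ range N, (θ + i) = ewensMoment θ N k := by
  induction k with
  | zero =>
    have hpos : 0 < ∏ i ∈ range N, (θ + i) := prod_pos fun i _ => by positivity
    rw [Nat.sub_zero, div_self hpos.ne', ewensMoment_zero]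
  | succ k ih =>
    have hsub : N - k = N - (k + 1) + 1 := by omega
    have hcast : (N : ℝ) + θ - (k + 1) = θ + (N - (k + 1) : ℕ) := by
      rw [Nat.cast_sub hk]
      push_cast
      ring
    have hne : θ + ((N - (k + 1) : ℕ) : ℝ) ≠ 0 := by positivity
    rw [ewensMoment_succ, ← ih (by omega), hsub, prod_range_succ, hcast, mul_div_right_comm,
      mul_inv_cancel_right₀ hne]

theorem sum_ewensWeight_mul_extendsIndicator (hθ : 0 < θ) (S : Finset (Fin N × Fin N)) :
    ∑ σ : Perm (Fin N), ewensWeight θ σ * extendsIndicator S σ =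
      ewensFunctional θ N (pairPolynomial θ S) := by
  rw [pairPolynomial]
  split_ifs with hS
  · have hcard : #S ≤ N := by
      simpa using hS.nodup_fst.length_le_card
    calc ∑ σ : Perm (Fin N), ewensWeight θ σ * extendsIndicator S σ
        = ewensSum θ S.toList / ∏ k ∈ range N, (θ + k) := by
          simp only [ewensSum, sum_div, mem_toList, ewensWeight, extendsIndicator, numCycles,
            card_parts_partition, mul_ite, mul_one, mul_zero, ite_div, zero_div]
      _ = ewensFunctional θ N (Polynomial.monomial #S (θ ^ closedCycles S.toList)) := by
          rw [ewensSum_eq θ hS, length_toList, Fintype.card_fin, mul_div_assoc,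
            prod_range_sub_div_prod_range hθ hcard, ewensFunctional_monomial, mul_comm]
  · rw [map_zero]
    refine sum_eq_zero fun σ _ => mul_eq_zero_of_right _ (if_neg fun hσ => hS ?_)
    exact .of_graph σ.injective (nodup_toList S) fun p hp => hσ p (mem_toList.1 hp)

theorem integral_ewensMeasure (hθ : 0 < θ) (φ : Perm (Fin N) → ℝ) :
    ∫ σ, φ σ ∂(ewensMeasure θ N) = ∑ σ, ewensWeight θ σ * φ σ := by
  rw [ewensMeasure, integral_finsetSum_measure]
  · refine sum_congr rfl fun σ _ => ?_
    rw [integral_smul_measure, integral_dirac, ENNReal.toReal_ofReal, smul_eq_mul, ewensWeight]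
    exact (ewensWeight_pos hθ σ).le
  · intro σ _
    exact (integrable_dirac (by simp)).smul_measure ENNReal.ofReal_ne_top

variable {Ω : Type*} [MeasurableSpace Ω] {P : Measure Ω} {σ : Ω → Perm (Fin N)} {ℓ : ℕ}

theorem jointCumulant_eq_jet_log_expSum (hθ : 0 < θ)
    (hσ : ProbabilityTheory.HasLaw σ (ewensMeasure θ N) P) (Y : Fin ℓ → Perm (Fin N) → ℝ) :
    jointCumulant P (fun h ω => Y h (σ ω)) =
      jet (fun t => Real.log (expSum (ewensWeight θ) Y t)) univ := by
  rw [jet_univ ((contDiff_expSum _ _).log fun t => (expSum_pos (ewensWeight_pos hθ) Y t).ne'),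
    jointCumulant]
  congr 2
  funext t
  rw [expSum, ← integral_ewensMeasure hθ fun ρ => Real.exp (∑ h, t h * Y h ρ), ← hσ.map_eq,
    integral_map hσ.aemeasurable Measurable.of_discrete.aestronglyMeasurable]

theorem jointCumulant_extendsIndicator (hθ : 0 < θ)
    (hσ : ProbabilityTheory.HasLaw σ (ewensMeasure θ N) P) (U : Fin ℓ → Finset (Fin N × Fin N))
    (hℓ : 0 < ℓ) :
    jointCumulant P (fun h ω => extendsIndicator (U h) (σ ω)) =
      unipotentLog (SetSeries.mapLinear (ewensFunctional θ N) (pairSeries θ U)) univ := by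
  let Y : Fin ℓ → Perm (Fin N) → ℝ := fun h ρ => extendsIndicator (U h) ρ
  have hjet : jet (expSum (ewensWeight θ) Y) =
      SetSeries.mapLinear (ewensFunctional θ N) (pairSeries θ U) := by
    refine SetSeries.ext fun Δ => ?_
    rw [jet_expSum, SetSeries.mapLinear_apply, pairSeries,
      ← sum_ewensWeight_mul_extendsIndicator hθ]
    exact sum_congr rfl fun ρ _ => congrArg _ (prod_extendsIndicator U Δ ρ)
  rw [jointCumulant_eq_jet_log_expSum hθ hσ Y]
  refine SetSeries.apply_eq_unipotentLog_apply
    (SetSeries.mapLinear_ewensFunctional_apply_empty (pairSeries_apply_empty θ U))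
    (a := ⟨0, hℓ⟩) ?_ (mem_univ _)
  rw [← hjet]
  exact eulerDeriv_jet_eq_mul_log (contDiff_expSum _ _) (expSum_pos (ewensWeight_pos hθ) Y) _

end EwensMeasure

section UniformBound

open Finset Filter Asymptotics MeasureTheory Polynomial

theorem exists_forall_abs_le_of_isBigO {γ : Type*} [Finite γ] (u v : γ → ℕ → ℝ) :
    ∃ C : ℝ, ∀ c, u c =O[atTop] v c → ∀ N, 0 < v c N → |u c N| ≤ C * v c N := by
  have hbound (c : γ) : ∃ C : ℝ, u c =O[atTop] v c → ∀ N, 0 < v c N → |u c N| ≤ C * v c N := by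
    by_cases hc : u c =O[atTop] v c
    · obtain ⟨C, -, hC⟩ := bound_of_isBigO_nat_atTop hc
      refine ⟨C, fun _ N hN => ?_⟩
      simpa only [Real.norm_eq_abs, abs_of_pos hN] using hC hN.ne'
    · exact ⟨0, fun h => absurd h hc⟩
  choose C hC using hbound
  obtain ⟨D, hD⟩ := Finite.exists_le C
  exact ⟨D, fun c hc N hN => (hC c hc N hN).trans (mul_le_mul_of_nonneg_right (hD c) hN.le)⟩

universe v w

theorem exists_abs_jointCumulant_le {θ : ℝ} (hθ : 0 < θ) (r : ℕ) :
    ∃ C : ℝ, ∀ {ℓ N : ℕ} {U : Fin ℓ → Finset (Fin N × Fin N)} {β : Type v} [DecidableEq β]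
      {comp : Fin ℓ → β} {Ω : Type w} [MeasurableSpace Ω] {P : Measure Ω}
      {σ : Ω → Equiv.Perm (Fin N)}, 0 < ℓ → ℓ ≤ r → #(univ.biUnion U) ≤ r → 1 ≤ N →
      (∀ h h', comp h ≠ comp h' → VertexDisjoint (U h) (U h')) →
      ProbabilityTheory.HasLaw σ (ewensMeasure θ N) P →
      |jointCumulant P fun h ω => extendsIndicator (U h) (σ ω)| ≤
        C * ((N : ℝ)⁻¹) ^ (#(univ.biUnion U) + #(univ.image comp) - 1) := by
  obtain ⟨V, hV, hVmem⟩ := exists_finite_pairPolynomial_mem θ r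
  have := hV.to_subtype
  -- The cumulant depends on `N` and on the system of polynomials only, and finitely many systems
  -- occur, for all `N` together.
  let Config : Type := Σ ℓ : Fin (r + 1), (Finset (Fin ℓ) → V) × Fin (2 * r + 1)
  obtain ⟨C, hC⟩ := exists_forall_abs_le_of_isBigO
    (fun (c : Config) N => unipotentLog (SetSeries.mapLinear (ewensFunctional θ N)
      fun Δ => (c.2.1 Δ : ℝ[X])) univ)
    (fun c N => ((N : ℝ)⁻¹) ^ (c.2.2 : ℕ))
  refine ⟨C, fun {ℓ N U β _ comp Ω _ P σ} hpos hℓ hU hN hsep hσ => ?_⟩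
  have hmem (Δ : Finset (Fin ℓ)) : pairSeries θ U Δ ∈ V :=
    hVmem _ ((card_le_card (biUnion_subset_biUnion_of_subset_left U (subset_univ Δ))).trans hU)
  have hexp : #(univ.biUnion U) + #(univ.image comp) - 1 < 2 * r + 1 := by
    have hcomp : #(univ.image comp) ≤ ℓ := card_image_le.trans_eq (card_fin ℓ)
    omega
  rw [jointCumulant_extendsIndicator hθ hσ U hpos]
  exact hC ⟨⟨ℓ, Nat.lt_succ_of_le hℓ⟩, fun Δ => ⟨_, hmem Δ⟩, ⟨_, hexp⟩⟩
    (unipotentLog_pairSeries_isBigO θ U comp hsep ⟨⟨0, hpos⟩, mem_univ _⟩) N (by positivity)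

end UniformBound

section Partitions

open Finset

variable {r N ℓ : ℕ}

theorem numParts_le (π : Setoid (Fin r)) : numParts π ≤ r :=
  (Nat.card_le_card_of_surjective _ Quotient.mk_surjective).trans_eq (Nat.card_fin r)

theorem connSetoid_graphG1 (i s : Fin r → Fin N) :
    connSetoid (graphG1 i s) = Setoid.ker fun j => (i j, s j) := by
  ext j k
  constructor
  · rintro ⟨walk⟩
    induction walk with
    | nil => rfl
    | cons hadj _ ih => exact (Prod.ext hadj.2.1 hadj.2.2).trans ih
  · intro hjk
    by_cases hne : j = k
    · exact hne ▸ (connSetoid _).refl j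
    · exact SimpleGraph.Adj.reachable ⟨hne, congrArg Prod.fst hjk, congrArg Prod.snd hjk⟩

theorem numParts_connSetoid_graphG1 (i s : Fin r → Fin N) :
    numParts (connSetoid (graphG1 i s)) = #(univ.image fun j => (i j, s j)) := by
  rw [numParts, connSetoid_graphG1, Nat.card_congr (Setoid.quotientKerEquivRange _),
    Nat.card_eq_fintype_card, ← Set.toFinset_card, Set.toFinset_range]

theorem vertexDisjoint_image_of_connSetoid_graphG2_le {i s : Fin r → Fin N} {Q : Setoid (Fin r)}
    (hQ : connSetoid (graphG2 i s) ≤ Q) {A B : Finset (Fin r)}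
    (hAB : ∀ j ∈ A, ∀ k ∈ B, (⟦j⟧ : Quotient Q) ≠ ⟦k⟧) :
    VertexDisjoint (A.image fun j => (i j, s j)) (B.image fun j => (i j, s j)) := by
  rintro p hp q hq
  obtain ⟨j, hj, rfl⟩ := mem_image.1 hp
  obtain ⟨k, hk, rfl⟩ := mem_image.1 hq
  have hdisj : ¬ (({i j, s j} : Set (Fin N)) ∩ {i k, s k}).Nonempty := fun hjk =>
    hAB j hj k hk (Quotient.sound (hQ (SimpleGraph.Adj.reachable
      ⟨fun h => hAB j hj k hk (congrArg _ h), hjk⟩)))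
  exact ⟨fun h => hdisj ⟨i j, .inl rfl, .inl h⟩, fun h => hdisj ⟨i j, .inl rfl, .inr h⟩,
    fun h => hdisj ⟨s j, .inr rfl, .inl h⟩, fun h => hdisj ⟨s j, .inr rfl, .inr h⟩⟩

variable {τ : Finpartition (univ : Finset (Fin r))}
  (e : Fin ℓ ≃ {A : Finset (Fin r) // A ∈ τ.parts})

include e in
theorem card_index_le_of_equiv_parts : ℓ ≤ r := by
  simpa using (Fintype.card_congr e).trans_le (by simpa using τ.card_parts_le_card)

theorem exists_mem_block (j : Fin r) : ∃ h, j ∈ (e h).1 := by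
  refine ⟨e.symm ⟨τ.part j, τ.part_mem.2 (mem_univ j)⟩, ?_⟩
  rw [Equiv.apply_symm_apply]
  exact τ.mem_part (mem_univ j)

theorem biUnion_block : univ.biUnion (fun h => (e h).1) = univ :=
  eq_univ_of_forall fun j => by simpa using exists_mem_block e j

theorem exists_surjective_blockLabel {Q : Setoid (Fin r)} (hQ : partitionSetoid τ ≤ Q) :
    ∃ comp : Fin ℓ → Quotient Q, comp.Surjective ∧ ∀ h, ∀ j ∈ (e h).1, comp h = ⟦j⟧ := by
  choose b hb using fun h => τ.nonempty_of_mem_parts (e h).2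
  have hcomp (h : Fin ℓ) (j : Fin r) (hj : j ∈ (e h).1) : (⟦b h⟧ : Quotient Q) = ⟦j⟧ :=
    Quotient.sound (hQ ((τ.part_eq_of_mem (e h).2 (hb h)).trans
      (τ.part_eq_of_mem (e h).2 hj).symm))
  refine ⟨fun h => ⟦b h⟧, fun q => ?_, hcomp⟩
  induction q using Quotient.inductionOn with
  | _ j => exact (exists_mem_block e j).imp fun h hj => hcomp h j hj

end Partitions

theorem inv_pow_add_sub_one {x : ℝ} (m : ℕ) {n : ℕ} (hn : 0 < n) :
    x⁻¹ ^ (m + n - 1) = x ^ (-(m : ℤ) - n + 1) := by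
  rw [inv_pow, ← zpow_natCast, ← zpow_neg]
  congr 1
  omega

theorem theorem1p4 (θ : ℝ) (hθ : 0 < θ) (r : ℕ) (hr : 1 ≤ r) :
    ∃ C : ℝ, ∀ (ℓ : ℕ) (τ : Finpartition (Finset.univ : Finset (Fin r)))
      (e : Fin ℓ ≃ {A : Finset (Fin r) // A ∈ τ.parts})
      (N : ℕ) (_ : 1 ≤ N) (i s : Fin r → Fin N)
      (Ω : Type*) [MeasurableSpace Ω] (P : Measure Ω) [IsProbabilityMeasure P]
      (σ : Ω → Equiv.Perm (Fin N)) (_ : ProbabilityTheory.HasLaw σ (ewensMeasure θ N) P),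
      |jointCumulant P
          (fun (h : Fin ℓ) (ω : Ω) => ∏ j ∈ (e h).1, elemVar σ (i j) (s j) ω)| ≤
        C * (N : ℝ) ^ (-(numParts (connSetoid (graphG1 i s)) : ℤ)
          - (numParts (connSetoid (graphG2 i s) ⊔ partitionSetoid τ) : ℤ) + 1) := by
  classical
  obtain ⟨C, hC⟩ := exists_abs_jointCumulant_le hθ r
  refine ⟨C, fun ℓ τ e N hN i s Ω _ P _ σ hσ => ?_⟩
  let Q : Setoid (Fin r) := connSetoid (graphG2 i s) ⊔ partitionSetoid τ
  let U : Fin ℓ → Finset (Fin N × Fin N) := fun h => (e h).1.image fun j => (i j, s j)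
  obtain ⟨comp, hsurj, hcomp⟩ := exists_surjective_blockLabel e (le_sup_right : _ ≤ Q)
  have hK : (Finset.univ.biUnion U).card = numParts (connSetoid (graphG1 i s)) := by
    rw [numParts_connSetoid_graphG1, ← biUnion_block e, Finset.biUnion_image]
  have hc : (Finset.univ.image comp).card = numParts Q := by
    rw [Finset.image_univ_of_surjective hsurj, Finset.card_univ, numParts, Nat.card_eq_fintype_card]
  have hsep (h h' : Fin ℓ) (hne : comp h ≠ comp h') : VertexDisjoint (U h) (U h') :=
    vertexDisjoint_image_of_connSetoid_graphG2_le (le_sup_left : _ ≤ Q) fun j hj k hk =>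
      hcomp h j hj ▸ hcomp h' k hk ▸ hne
  have hℓ : 0 < ℓ := (exists_mem_block e ⟨0, hr⟩).choose.pos
  have hQ : 0 < numParts Q :=
    hc ▸ Finset.card_pos.2 ⟨_, Finset.mem_image_of_mem comp (Finset.mem_univ ⟨0, hℓ⟩)⟩
  have hbound := hC hℓ (card_index_le_of_equiv_parts e) (hK ▸ numParts_le _) hN hsep hσ
  rw [hK, hc, inv_pow_add_sub_one _ hQ] at hbound
  simpa only [prod_elemVar] using hbound
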